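/- **Setting.** Let $\Omega\subset\mathbb R^2$ be a bounded open set with $\operatorname{int}\overline\Omega=\Omega$ (for instance a bounded Lipschitz polygon), and let an interface $\Gamma$ split it: $\Omega\setminus\Gamma=\Omega^-\cup\Omega^+$ with $\Omega^\pm$ disjoint and open, both satisfying a uniform interior cone condition at the points of their closures (as Lipschitz domains do). The diffusion coefficient is $\beta=\beta^\pm$ on $\Omega^\pm$, with $0<\beta_0\le\beta^\pm\le\beta_1$ on $\overline{\Omega^\pm}$. Fix linearly independent $a,b\in\mathbb R^2$. *Mesh.* For $h>0$, $\mathcal T_h$ is a uniform triangulation of $\Omega$: finitely many triangles with union $\overline\Omega$, each of the form $\{x,\,x+ha,\,x+h(a+b)\}$ or $\{x,\,x+hb,\,x+h(a+b)\}$ with $x\in o+h(\mathbb Z a+\mathbb Z b)$ for some origin $o$; so $\operatorname{diam}T$ is a fixed multiple of $h$. It resolves $\Gamma$: an element $T$ is either *regular* (its interior lies in $\Omega^-$ or in $\Omega^+$), or an *interface element*: $\Gamma$ meets the interior of $T$, and $\overline\Gamma$ meets $\partial T$ in exactly two points $z_4,z_5$, not on a common (closed) edge, and the two arcs of $\partial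 T$ between them lie in $\overline{\Omega^-}$ and in $\overline{\Omega^+}$, respectively. The segment $z_4z_5$ cuts $T$ into $T^-$ and $T^+$, named after these arcs. The body-fitted mesh $\widehat{\mathcal T}_h$ keeps the regular elements and cuts every interface element along $z_4z_5$; if one of the two parts is a quadrilateral, it is cut further into two triangles by one of its diagonals (any choice, in particular one by an angle condition). $\widehat{\mathcal T}_h^\pm$ consists of its triangles on the $\pm$ side. *Immersed finite element space.* $V_h$ consists of the functions $v$ that are affine on each regular element, that on each interface element are affine on $T^-$ and on $T^+$, continuous at $z_4$ and $z_5$, and satisfy $\beta^+\partial_n v^+=\beta^-\partial_n v^-$ with $n$ normal to $z_4z_5$ (for variable coefficients, $\beta^\pm$ is replaced here by its value at an arbitrarily chosen point of $T\cap\overline{\Omega^\pm}$), and that are continuous at the vertices of $\mathcal T_h$. On edges $v$ may be two-valued. Put $|v|_{1,h}=\big(\sum_{T\in\mathcal T_h}|v|_{1,T}^2\big)^{1/2}$. *Enrichment.* $E_hv$ is the continuous piecewise linear function on $\widehat{\mathcal T}_h$ whose value at a vertex $z$ is the average of $v|_{\widehat T}(z)$ over all $\widehat T\in\widehat{\mathcal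 T}_h$ with vertex $z$. *Immersed polynomial preserving recovery.* For a vertex $z$ of $\widehat{\mathcal T}_h^\pm$ let $K^\pm(z,n)$ be the set of vertices in the first $n$ layers of triangles of $\widehat{\mathcal T}_h^\pm$ around $z$ ($K^\pm(z,0)=\{z\}$; $K^\pm(z,n+1)$ adds all vertices of the triangles that have a vertex in $K^\pm(z,n)$). A choice of layer numbers $n^\pm_z$ is $(\kappa,N)$-*admissible* if, for both signs and all vertices $z$ of $\widehat{\mathcal T}_h^\pm$, $n^\pm_z\le N$ and the least-squares fit of a quadratic polynomial, in the scaled coordinates $(x-z)/h$ and the monomial basis, at the points of $K^\pm(z,n^\pm_z)$ has a normal matrix with smallest eigenvalue at least $\kappa$. Then $G_h^Iw$, for $w$ continuous and piecewise linear on $\widehat{\mathcal T}_h$, is the vector field that on every $\widehat T\in\widehat{\mathcal T}_h^\pm$ is affine with value $\nabla p^\pm_z(z)$ at each vertex $z$ of $\widehat T$, where $p^\pm_z$ is the quadratic polynomial minimizing $\sum_{x\in K^\pm(z,n^\pm_z)}|p(x)-w(x)|^2$. The gradient recovery operator is $R_hv=G_h^I(E_hv)$. **Theorem.** 1. There are $\kappa>0$,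 $N\in\mathbb N$ and $h_0>0$, depending only on $\Omega^\pm,a,b$, such that for all $h<h_0$ every such mesh has a $(\kappa,N)$-admissible choice of layer numbers, so that $R_h$ is well defined. 2. For all $\kappa>0$ and $N\in\mathbb N$ there is a constant $C$, independent of $h$, of the mesh, of its position relative to $\Gamma$, of the $(\kappa,N)$-admissible choice of layer numbers and of the points at which $\beta^\pm$ is frozen, such that $$\|R_hv\|_{0,\Omega^-\cup\Omega^+}\le C\,|v|_{1,h}\qquad\text{for all }v\in V_h .$$ In particular this holds for $v=u_h\in V_h$, the symmetric and consistent or the Petrov–Galerkin immersed finite element solution. -/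

import Mathlib

open MeasureTheory
open scoped ENNReal NNReal

noncomputable section

namespace IFEM

/-- The Euclidean plane. -/
abbrev Plane : Type := EuclideanSpace ℝ (Fin 2)

/-- The two sides of the interface. -/
inductive Side where
  | minus
  | plus
  deriving DecidableEq

/-- The opposite side. -/
def Side.other : Side → Side
  | .minus => .plus
  | .plus => .minus

/-! ### The interface geometry -/

/-- A bounded domain `Ω`, and the two disjoint open parts `Ω⁻`, `Ω⁺` into which the interface
splits it. The equation `interior (closure Ω) = Ω` (no slits or punctures) holds for every domain
with Lipschitz boundary. -/
structure InterfaceDomain where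
  Ω : Set Plane
  sub : Side → Set Plane
  bounded : Bornology.IsBounded Ω
  regular : interior (closure Ω) = Ω
  sub_open : ∀ σ, IsOpen (sub σ)
  sub_subset : ∀ σ, sub σ ⊆ Ω
  sub_disjoint : Disjoint (sub .minus) (sub .plus)

/-- The interface `Γ = Ω \ (Ω⁻ ∪ Ω⁺)`. -/
def InterfaceDomain.Γ (G : InterfaceDomain) : Set Plane :=
  G.Ω \ (G.sub .minus ∪ G.sub .plus)

/-- The uniform interior cone condition (implied by a Lipschitz boundary); the cone of opening
`arcsin δ` and height `r` with vertex `x` and axis `ξ` is written as a union of balls. -/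
def UniformCone (U : Set Plane) : Prop :=
  ∃ r : ℝ, 0 < r ∧ ∃ δ : ℝ, 0 < δ ∧ ∀ x ∈ closure U, ∃ ξ : Plane, ‖ξ‖ = 1 ∧
    ∀ t : ℝ, 0 < t → t < r → Metric.ball (x + t • ξ) (δ * t) ⊆ U

/-! ### Uniform triangulations cut by the interface -/

/-- The closed triangle with vertices `V 0`, `V 1`, `V 2`. -/
def tri (V : Fin 3 → Plane) : Set Plane := convexHull ℝ (Set.range V)

/-- Labels of the triangles of the uniform (three-direction) triangulation of the plane: a
parallelogram of the lattice, and one of the two triangles into which its diagonal cuts it. -/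
abbrev Cell : Type := ℤ × ℤ × Bool

/-- The vertices of the triangle `τ` of the uniform triangulation with origin `o`, lattice
vectors `h a`, `h b`, and diagonals in the direction `a + b`. -/
def cellVert (o a b : Plane) (h : ℝ) (τ : Cell) : Fin 3 → Plane :=
  let x : Plane := o + h • ((τ.1 : ℝ) • a + (τ.2.1 : ℝ) • b)
  if τ.2.2 then ![x, x + h • b, x + h • (a + b)] else ![x, x + h • a, x + h • (a + b)]

/-- The position of the interface in an element with vertices `V`. Write `A = V k`,
`B = V (k + 1)`, `C = V (k + 2)` (indices mod 3).
* `regular σ`: the interface does not enter the interior, which lies on the side `σ`.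
* `corner k s t d σ`: the intersection points are `z₄ = A + s (B - A)` and `z₅ = A + t (C - A)`;
  `A` is on the side `σ` and `B`, `C` are on the other one. The flag `d` is the choice of the
  auxiliary line: from `B` to `z₅` or from `C` to `z₄`.
* `through k t σ`: the intersection points are the vertex `z₄ = A` and `z₅ = B + t (C - B)`;
  `B` is on the side `σ` and `C` on the other one. -/
inductive Cut where
  | regular (σ : Side)
  | corner (k : Fin 3) (s t : ℝ) (d : Bool) (σ : Side)
  | through (k : Fin 3) (t : ℝ) (σ : Side)

/-- The first intersection point (no meaning for a regular element). -/
def Cut.z₄ (V : Fin 3 → Plane) : Cut → Plane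
  | .regular _ => V 0
  | .corner k s _ _ _ => AffineMap.lineMap (V k) (V (k + 1)) s
  | .through k _ _ => V k

/-- The second intersection point (no meaning for a regular element). -/
def Cut.z₅ (V : Fin 3 → Plane) : Cut → Plane
  | .regular _ => V 0
  | .corner k _ t _ _ => AffineMap.lineMap (V k) (V (k + 2)) t
  | .through k t _ => AffineMap.lineMap (V (k + 1)) (V (k + 2)) t

/-- The element is an interface element. -/
def Cut.IsInterface : Cut → Prop
  | .regular _ => False
  | .corner _ _ _ _ _ => True
  | .through _ _ _ => True

/-- `c` describes how the interface of `G` meets the element with vertices `V`: either the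
interior of the element is on one side, or the interface passes through the interior and meets
the boundary in exactly two points, not on a common edge, which cut the boundary into one arc on
the side `Ω⁻` and one on the side `Ω⁺`. -/
def Cut.Fits (G : InterfaceDomain) (V : Fin 3 → Plane) : Cut → Prop
  | .regular σ => interior (tri V) ⊆ G.sub σ
  | .corner k s t d σ =>
      let P := (Cut.corner k s t d σ).z₄ V
      let Q := (Cut.corner k s t d σ).z₅ V
      (0 < s ∧ s < 1) ∧ (0 < t ∧ t < 1) ∧
      (G.Γ ∩ interior (tri V)).Nonempty ∧
      closure G.Γ ∩ frontier (tri V) = {P, Q} ∧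
      segment ℝ (V k) P ∪ segment ℝ (V k) Q ⊆ closure (G.sub σ) ∧
      segment ℝ P (V (k + 1)) ∪ segment ℝ (V (k + 1)) (V (k + 2)) ∪ segment ℝ (V (k + 2)) Q ⊆
        closure (G.sub σ.other)
  | .through k t σ =>
      let P := (Cut.through k t σ).z₄ V
      let Q := (Cut.through k t σ).z₅ V
      (0 < t ∧ t < 1) ∧
      (G.Γ ∩ interior (tri V)).Nonempty ∧
      closure G.Γ ∩ frontier (tri V) = {P, Q} ∧
      segment ℝ P (V (k + 1)) ∪ segment ℝ (V (k + 1)) Q ⊆ closure (G.sub σ) ∧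
      segment ℝ P (V (k + 2)) ∪ segment ℝ (V (k + 2)) Q ⊆ closure (G.sub σ.other)

/-- A uniform triangulation `𝒯_h` of `Ω`, with the position of the interface in its elements and
the choice of the auxiliary lines. -/
structure CutMesh (G : InterfaceDomain) (a b : Plane) (h : ℝ) where
  o : Plane
  cells : Finset Cell
  covers : ⋃ τ ∈ cells, tri (cellVert o a b h τ) = closure G.Ω
  cut : Cell → Cut
  fits : ∀ τ ∈ cells, (cut τ).Fits G (cellVert o a b h τ)

/-- A triangle of the local body-fitted mesh: the element of `𝒯_h` that contains it, the side of
the discrete interface on which it lies, and its vertices. -/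
structure FineTri where
  cell : Cell
  side : Side
  vert : Fin 3 → Plane

open Classical in
/-- The triangles into which an element is divided: a regular element is kept; an interface
element is divided by the segment `z₄ z₅`, and a quadrilateral part also by the auxiliary line. -/
def Cut.pieces (τ : Cell) (V : Fin 3 → Plane) : Cut → Finset FineTri
  | .regular σ => {⟨τ, σ, V⟩}
  | .corner k s t d σ =>
      let A := V k
      let B := V (k + 1)
      let C := V (k + 2)
      let P := (Cut.corner k s t d σ).z₄ V
      let Q := (Cut.corner k s t d σ).z₅ V
      if d then {⟨τ, σ, ![A, P, Q]⟩, ⟨τ, σ.other, ![B, C, Q]⟩, ⟨τ, σ.other, ![B, Q, P]⟩}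
      else {⟨τ, σ, ![A, P, Q]⟩, ⟨τ, σ.other, ![B, C, P]⟩, ⟨τ, σ.other, ![C, Q, P]⟩}
  | .through k t σ =>
      let A := V k
      let B := V (k + 1)
      let C := V (k + 2)
      let Q := (Cut.through k t σ).z₅ V
      {⟨τ, σ, ![A, B, Q]⟩, ⟨τ, σ.other, ![A, Q, C]⟩}

namespace CutMesh

variable {G : InterfaceDomain} {a b : Plane} {h : ℝ}

/-- The vertices of the element `τ` of `𝒯_h`. -/
def vert (M : CutMesh G a b h) (τ : Cell) : Fin 3 → Plane := cellVert M.o a b h τ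

open Classical in
/-- The local body-fitted mesh `𝒯̂_h`. -/
def fine (M : CutMesh G a b h) : Finset FineTri :=
  M.cells.biUnion fun τ => (M.cut τ).pieces τ (M.vert τ)

open Classical in
/-- The vertices of the part `𝒯̂_h^σ` of the body-fitted mesh on the side `σ`. -/
def nodes (M : CutMesh G a b h) (σ : Side) : Finset Plane :=
  (M.fine.filter fun T => T.side = σ).biUnion fun T => Finset.univ.image T.vert

/-! ### The immersed finite element space -/

/-- The local space `V_h(T)` of the element `τ`, with the values `βm`, `βp` of the diffusion
coefficient on the two sides: affine functions on a regular element; on an interface element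
functions that are affine on `T⁻` and on `T⁺`, continuous at `z₄` and `z₅`, and with
`β⁺ ∂ₙ v⁺ = β⁻ ∂ₙ v⁻` for the normal `n` of `z₄ z₅`. -/
def LocalIFE (M : CutMesh G a b h) (βm βp : ℝ) (τ : Cell) (w : Plane → ℝ) : Prop :=
  ((M.cut τ).IsInterface →
    ∃ (α : Side → ℝ) (g : Side → Plane),
      (∀ T ∈ (M.cut τ).pieces τ (M.vert τ), ∀ x ∈ tri T.vert,
        w x = α T.side + inner ℝ (g T.side) x) ∧
      (∀ z ∈ ({(M.cut τ).z₄ (M.vert τ), (M.cut τ).z₅ (M.vert τ)} : Set Plane),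
        α .plus + inner ℝ (g .plus) z = α .minus + inner ℝ (g .minus) z) ∧
      (∀ n : Plane, inner ℝ n ((M.cut τ).z₅ (M.vert τ) - (M.cut τ).z₄ (M.vert τ)) = 0 →
        βp * inner ℝ (g .plus) n = βm * inner ℝ (g .minus) n)) ∧
  (¬ (M.cut τ).IsInterface →
    ∃ (α : ℝ) (g : Plane), ∀ x ∈ tri (M.vert τ), w x = α + inner ℝ g x)

/-- Points at which the diffusion coefficient is frozen on each interface element: `ξ τ σ` is a
point of the element on the side `σ`. For constant `β⁻`, `β⁺` the choice plays no role. -/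
def IsSampling (M : CutMesh G a b h) (ξ : Cell → Side → Plane) : Prop :=
  ∀ τ ∈ M.cells, (M.cut τ).IsInterface → ∀ σ, ξ τ σ ∈ tri (M.vert τ) ∩ closure (G.sub σ)

/-- The immersed finite element space `V_h`. A function in it can have two values on an edge, and
is given by its restrictions `v τ` to the closed elements; outside of its element `v τ` has no
meaning. The last condition is the continuity at the vertices of `𝒯_h`. -/
def IFESpace (M : CutMesh G a b h) (β : Side → Plane → ℝ) (ξ : Cell → Side → Plane)
    (v : Cell → Plane → ℝ) : Prop :=
  (∀ τ ∈ M.cells, M.LocalIFE (β .minus (ξ τ .minus)) (β .plus (ξ τ .plus)) τ (v τ)) ∧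
  ∀ τ ∈ M.cells, ∀ τ' ∈ M.cells, ∀ i j : Fin 3,
    M.vert τ i = M.vert τ' j → v τ (M.vert τ i) = v τ' (M.vert τ' j)

/-- The broken seminorm `|v|_{1,h} = (∑_{T ∈ 𝒯_h} |v|²_{1,T})^{1/2}`. -/
def brokenSeminorm (M : CutMesh G a b h) (v : Cell → Plane → ℝ) : ℝ≥0∞ :=
  (∑ τ ∈ M.cells,
    (eLpNorm (fderiv ℝ (v τ)) 2 (volume.restrict (tri (M.vert τ)))) ^ 2) ^ (1 / 2 : ℝ)

/-! ### The enriching operator -/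

open Classical in
/-- The enriching operator `E_h`, at a vertex `z` of the body-fitted mesh: the average of
`v|_{T̂}(z)` over all the triangles `T̂` of the body-fitted mesh with vertex `z`. The continuous
piecewise linear function `E_h v` is represented by its nodal values. -/
def enrich (M : CutMesh G a b h) (v : Cell → Plane → ℝ) (z : Plane) : ℝ :=
  ((M.fine.filter fun T => ∃ k, T.vert k = z).card : ℝ)⁻¹ *
    ∑ T ∈ M.fine.filter (fun T => ∃ k, T.vert k = z), v T.cell z

/-! ### Immersed polynomial preserving recovery -/

open Classical in
/-- The vertices of the first `n` layers of triangles of `𝒯̂_h^σ` around `z`. -/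
def layers (M : CutMesh G a b h) (σ : Side) (z : Plane) : ℕ → Finset Plane
  | 0 => {z}
  | n + 1 => layers M σ z n ∪
      (M.fine.filter fun T => T.side = σ ∧ ∃ k, T.vert k ∈ layers M σ z n).biUnion
        fun T => Finset.univ.image T.vert

end CutMesh

/-- The quadratic polynomial with coefficients `c`. -/
def quad (c : Fin 6 → ℝ) (y : Plane) : ℝ :=
  c 0 + c 1 * y 0 + c 2 * y 1 + c 3 * y 0 ^ 2 + c 4 * (y 0 * y 1) + c 5 * y 1 ^ 2

/-- The sum of squares of the least-squares fit at the sampling points `K`, of a quadratic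
polynomial written in the local coordinates `(x - z) / h`, to the values `w`. -/
def fitError (h : ℝ) (z : Plane) (K : Finset Plane) (w : Plane → ℝ) (c : Fin 6 → ℝ) : ℝ :=
  ∑ x ∈ K, (quad c (h⁻¹ • (x - z)) - w x) ^ 2

/-- The least-squares problem for the sampling points `K` is well conditioned: the smallest
eigenvalue of its normal matrix, in the local coordinates, is at least `κ`. -/
def WellConditioned (κ h : ℝ) (z : Plane) (K : Finset Plane) : Prop :=
  ∀ c : Fin 6 → ℝ, κ * ∑ i, c i ^ 2 ≤ ∑ x ∈ K, quad c (h⁻¹ • (x - z)) ^ 2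

open Classical in
/-- The coefficients of the quadratic polynomial that fits `w` best at the points of `K`. -/
def fitCoeff (h : ℝ) (z : Plane) (K : Finset Plane) (w : Plane → ℝ) : Fin 6 → ℝ :=
  if H : ∃ c, ∀ c', fitError h z K w c ≤ fitError h z K w c' then H.choose else 0

/-- The gradient at `z` of the quadratic polynomial that fits `w` best at the points of `K`. -/
def fitGradient (h : ℝ) (z : Plane) (K : Finset Plane) (w : Plane → ℝ) : Plane :=
  gradient (fun x => quad (fitCoeff h z K w) (h⁻¹ • (x - z))) z

/-- Twice the signed area spanned by two vectors. -/
def cross (u w : Plane) : ℝ := u 0 * w 1 - u 1 * w 0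

/-- The barycentric coordinate of `x` for the vertex `V k` of a triangle. -/
def bary (V : Fin 3 → Plane) (k : Fin 3) (x : Plane) : ℝ :=
  cross (V (k + 1) - x) (V (k + 2) - x) / cross (V 1 - V 0) (V 2 - V 0)

namespace CutMesh

variable {G : InterfaceDomain} {a b : Plane} {h : ℝ}

/-- `n` selects the patches for the recovery on the two sides: the patch for the vertex `z` of
`𝒯̂_h^σ` consists of the first `n σ z ≤ N` layers of triangles of `𝒯̂_h^σ` around `z`, and the
fit of a quadratic polynomial at its vertices has condition constant `κ`. -/
def IsPatchChoice (M : CutMesh G a b h) (κ : ℝ) (N : ℕ) (n : Side → Plane → ℕ) : Prop :=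
  ∀ σ, ∀ z ∈ M.nodes σ,
    n σ z ≤ N ∧ WellConditioned κ h z (M.layers σ z (n σ z))

/-- The immersed polynomial preserving recovery `G_h^I w`: polynomial preserving recovery on
`𝒯̂_h⁻` and on `𝒯̂_h⁺` separately, that is, at the vertices of `𝒯̂_h^σ` the gradient of the
fitted quadratic polynomial, and linear interpolation on every triangle of `𝒯̂_h^σ`. (The
interiors of the triangles are disjoint and cover `Ω` up to a null set.) -/
def ippr (M : CutMesh G a b h) (n : Side → Plane → ℕ) (w : Plane → ℝ) (x : Plane) : Plane :=
  ∑ T ∈ M.fine, (interior (tri T.vert)).indicator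
    (fun y => ∑ k, bary T.vert k y •
      fitGradient h (T.vert k) (M.layers T.side (T.vert k) (n T.side (T.vert k))) w) x

/-- The gradient recovery operator `R_h v = G_h^I (E_h v)`. -/
def recover (M : CutMesh G a b h) (n : Side → Plane → ℕ) (v : Cell → Plane → ℝ) :
    Plane → Plane :=
  M.ippr n (M.enrich v)

end CutMesh

end IFEM

end

/-!
The recovery operator is local: the recovered gradient at a vertex `z` depends only on the nodal
values in the patch around `z`, a bounded number of elements. Everything therefore comes down to
estimates on patches whose constants do not depend on the position of the interface, and to a
geometric fact about the existence of patches.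

*Stability.* On an interface element the jump of the gradient of `v ∈ V_h` is normal to the
discrete interface, so testing the flux condition with this jump bounds the gradients on the two
sides by each other, with a constant that depends only on `β₁ / β₀` (`norm_le_of_flux`). Hence the
energy of `v` on an element controls both gradients, however small one of the two parts may be
(`ComparablyAffine.sq_mul_volume_le`), and with them the oscillation of `v` over the vertices of
the pieces (`ComparablyAffine.abs_sub_le`). Elements with a common point share a vertex of the
uniform mesh, where `v` is continuous; so the jumps of `v`, and its distance to the averages
`E_h v`, are controlled by the gradients as well (`CutMesh.NodalBound.abs_enrich_sub_le`).
The least-squares fit reproduces constants, so its gradient at `z` is bounded by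
`h⁻¹ max |E_h v - E_h v (z)|` over the patch, with a constant that depends on the conditioning and
on the number of points (`norm_fitGradient_le`); a walk through the layers bounds this by
the gradients of `v` on nearby elements. Since all elements have the same area and every element is
near a bounded number of others, the sum of the squares gives the `L²` bound
(`CutMesh.exists_stability`).

*Existence of patches.* Two elements with a common point `x ∈ Ω^σ` have a common vertex of the
body-fitted mesh on the side `σ`: the interface meets an edge at most once, so the part of the edge
around `x` on the side `σ` ends at the same lattice point for both elements
(`CutMesh.exists_common_isNode`). So the layers of the `σ`-mesh around a vertex spread through
all elements that meet a given connected subset of `Ω^σ` (`CutMesh.mem_layers_of_isPreconnected`).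
By the cone condition, such a set is the axis of a cone of height of order `h`, together with a ball
at its end. The element of the vertex itself does meet `Ω^σ`: otherwise a point of its boundary in
the closure of `Ω^σ` would be interior to the closure of `Ω`, hence in `Ω` and in `Ω^σ`
(`CutMesh.exists_mem_sub_of_isNode`). The ball contains a lattice triangle of side two, whose six
points are unisolvent for quadratic polynomials, with a uniform condition constant by compactness
(`exists_stencil_bound`).
-/

namespace IFEM

/-! ### Triangles in barycentric coordinates -/

theorem mem_tri {V : Fin 3 → Plane} {x : Plane} :
    x ∈ tri V ↔ ∃ w : Fin 3 → ℝ, (∀ k, 0 ≤ w k) ∧ w 0 + w 1 + w 2 = 1 ∧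
      x = w 0 • V 0 + w 1 • V 1 + w 2 • V 2 := by
  constructor
  · intro hx
    refine convexHull_min (t := {x | ∃ w : Fin 3 → ℝ, (∀ k, 0 ≤ w k) ∧ w 0 + w 1 + w 2 = 1 ∧
      x = w 0 • V 0 + w 1 • V 1 + w 2 • V 2}) ?_ ?_ hx
    · rintro _ ⟨k, rfl⟩
      refine ⟨fun l => if l = k then 1 else 0, fun l => ?_, ?_, ?_⟩
      · dsimp only; split_ifs <;> norm_num
      · fin_cases k <;> simp
      · fin_cases k <;> simp
    · rintro x ⟨w, hw, hw1, rfl⟩ y ⟨u, hu, hu1, rfl⟩ s t hs ht hst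
      refine ⟨fun k => s * w k + t * u k, fun k => ?_, ?_, ?_⟩
      · have := hw k; have := hu k; positivity
      · linear_combination s * hw1 + t * hu1 + hst
      · module
  · rintro ⟨w, hw, hw1, rfl⟩
    have hv : ∀ k, V k ∈ tri V := fun k => subset_convexHull ℝ _ ⟨k, rfl⟩
    have := (convex_convexHull ℝ (Set.range V)).sum_mem (t := Finset.univ) (w := w) (z := V)
      (fun k _ => hw k) (by rw [Fin.sum_univ_three]; exact hw1) (fun k _ => hv k)
    rwa [Fin.sum_univ_three] at this

theorem vert_mem_tri (V : Fin 3 → Plane) (k : Fin 3) : V k ∈ tri V :=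
  subset_convexHull ℝ _ ⟨k, rfl⟩

theorem convex_tri (V : Fin 3 → Plane) : Convex ℝ (tri V) := convex_convexHull ℝ _

theorem isCompact_tri (V : Fin 3 → Plane) : IsCompact (tri V) :=
  (Set.finite_range V).isCompact_convexHull ℝ

theorem isClosed_tri (V : Fin 3 → Plane) : IsClosed (tri V) := (isCompact_tri V).isClosed

theorem tri_subset {V : Fin 3 → Plane} {s : Set Plane} (hs : Convex ℝ s) (hV : ∀ k, V k ∈ s) :
    tri V ⊆ s :=
  convexHull_min (by rintro _ ⟨k, rfl⟩; exact hV k) hs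

theorem segment_subset_tri (V : Fin 3 → Plane) (i j : Fin 3) : segment ℝ (V i) (V j) ⊆ tri V :=
  (convex_tri V).segment_subset (vert_mem_tri V i) (vert_mem_tri V j)

/-! ### Lattice coordinates -/

theorem cross_ne_zero {a b : Plane} (hab : LinearIndependent ℝ ![a, b]) : cross a b ≠ 0 := by
  intro h0
  rw [LinearIndependent.pair_iff] at hab
  unfold cross at h0
  have h1 := hab (b 0) (-a 0) (by
    ext k; fin_cases k
    · simp; ring
    · simp; linarith)
  have h2 := hab (b 1) (-a 1) (by
    ext k; fin_cases k
    · simp; linarith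
    · simp; ring)
  have h3 := hab 1 0 (by
    ext k; fin_cases k
    · simp; linarith [h1.2]
    · simp; linarith [h2.2])
  exact one_ne_zero h3.1

/-- The first coordinate of `x` with respect to the origin `o` and the lattice vectors `h a`,
`h b`. -/
noncomputable def latS (o a b : Plane) (h : ℝ) (x : Plane) : ℝ := cross (x - o) b / (h * cross a b)

/-- The second coordinate of `x` with respect to the origin `o` and the lattice vectors `h a`,
`h b`. -/
noncomputable def latT (o a b : Plane) (h : ℝ) (x : Plane) : ℝ := cross a (x - o) / (h * cross a b)

/-- The point with lattice coordinates `s`, `t`. -/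
def latPt (o a b : Plane) (h s t : ℝ) : Plane := o + h • (s • a + t • b)

section Lattice

variable {o a b : Plane} {h : ℝ}

theorem continuous_latS : Continuous (latS o a b h) := by
  unfold latS cross; fun_prop

theorem continuous_latT : Continuous (latT o a b h) := by
  unfold latT cross; fun_prop

theorem latS_latPt (hc : cross a b ≠ 0) (hh : h ≠ 0) (s t : ℝ) :
    latS o a b h (latPt o a b h s t) = s := by
  unfold latS latPt
  rw [div_eq_iff (mul_ne_zero hh hc)]
  simp [cross]; ring

theorem latT_latPt (hc : cross a b ≠ 0) (hh : h ≠ 0) (s t : ℝ) :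
    latT o a b h (latPt o a b h s t) = t := by
  unfold latT latPt
  rw [div_eq_iff (mul_ne_zero hh hc)]
  simp [cross]; ring

theorem latPt_latS_latT (hc : cross a b ≠ 0) (hh : h ≠ 0) (x : Plane) :
    latPt o a b h (latS o a b h x) (latT o a b h x) = x := by
  have key : ∀ k, h * (latS o a b h x * a k + latT o a b h x * b k) = x k - o k := by
    intro k
    unfold latS latT
    have e : h * (cross (x - o) b / (h * cross a b) * a k
        + cross a (x - o) / (h * cross a b) * b k)
        = (cross (x - o) b * a k + cross a (x - o) * b k) / cross a b := by
      field_simp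
    rw [e, div_eq_iff hc]
    fin_cases k <;> simp [cross] <;> ring
  ext k
  have := key k
  simp only [latPt, PiLp.add_apply, PiLp.smul_apply, smul_eq_mul]
  linarith

theorem latS_comb (hc : cross a b ≠ 0) (hh : h ≠ 0) {w₀ w₁ w₂ : ℝ} (hw : w₀ + w₁ + w₂ = 1)
    (x y z : Plane) : latS o a b h (w₀ • x + w₁ • y + w₂ • z) =
      w₀ * latS o a b h x + w₁ * latS o a b h y + w₂ * latS o a b h z := by
  unfold latS
  field_simp
  obtain rfl : w₀ = 1 - w₁ - w₂ := by linarith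
  simp [cross]; ring

theorem latT_comb (hc : cross a b ≠ 0) (hh : h ≠ 0) {w₀ w₁ w₂ : ℝ} (hw : w₀ + w₁ + w₂ = 1)
    (x y z : Plane) : latT o a b h (w₀ • x + w₁ • y + w₂ • z) =
      w₀ * latT o a b h x + w₁ * latT o a b h y + w₂ * latT o a b h z := by
  unfold latT
  field_simp
  obtain rfl : w₀ = 1 - w₁ - w₂ := by linarith
  simp [cross]; ring

theorem abs_cross_le (u w : Plane) : |cross u w| ≤ 2 * (‖u‖ * ‖w‖) := by
  have h1 := PiLp.norm_apply_le (p := 2) u 0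
  have h2 := PiLp.norm_apply_le (p := 2) u 1
  have h3 := PiLp.norm_apply_le (p := 2) w 0
  have h4 := PiLp.norm_apply_le (p := 2) w 1
  simp only [Real.norm_eq_abs] at h1 h2 h3 h4
  calc |cross u w| ≤ |u 0 * w 1| + |u 1 * w 0| := abs_sub _ _
    _ = |u 0| * |w 1| + |u 1| * |w 0| := by rw [abs_mul, abs_mul]
    _ ≤ ‖u‖ * ‖w‖ + ‖u‖ * ‖w‖ := by gcongr
    _ = _ := by ring

theorem abs_latS_sub_le (hc : cross a b ≠ 0) (hh : 0 < h) (x y : Plane) :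
    |latS o a b h x - latS o a b h y| ≤
      2 * (‖a‖ + ‖b‖) / |cross a b| * (h⁻¹ * ‖x - y‖) := by
  have hc' : 0 < |cross a b| := abs_pos.2 hc
  have e : latS o a b h x - latS o a b h y = cross (x - y) b / (h * cross a b) := by
    unfold latS; rw [← sub_div]; congr 1; simp [cross]; ring
  rw [e, abs_div, abs_mul, abs_of_pos hh, div_le_iff₀ (by positivity)]
  refine (abs_cross_le _ _).trans ?_
  have : 2 * (‖a‖ + ‖b‖) / |cross a b| * (h⁻¹ * ‖x - y‖) * (h * |cross a b|)
      = 2 * (‖x - y‖ * (‖a‖ + ‖b‖)) := by field_simp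
  rw [this]; gcongr; linarith [norm_nonneg a]

theorem abs_latT_sub_le (hc : cross a b ≠ 0) (hh : 0 < h) (x y : Plane) :
    |latT o a b h x - latT o a b h y| ≤
      2 * (‖a‖ + ‖b‖) / |cross a b| * (h⁻¹ * ‖x - y‖) := by
  have hc' : 0 < |cross a b| := abs_pos.2 hc
  have e : latT o a b h x - latT o a b h y = cross a (x - y) / (h * cross a b) := by
    unfold latT; rw [← sub_div]; congr 1; simp [cross]; ring
  rw [e, abs_div, abs_mul, abs_of_pos hh, div_le_iff₀ (by positivity)]
  refine (abs_cross_le _ _).trans ?_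
  have : 2 * (‖a‖ + ‖b‖) / |cross a b| * (h⁻¹ * ‖x - y‖) * (h * |cross a b|)
      = 2 * ((‖a‖ + ‖b‖) * ‖x - y‖) := by field_simp
  rw [this]; gcongr; linarith [norm_nonneg b]

/-! ### Cells of the uniform triangulation -/

/-- The lattice coordinates of the vertices of a cell. -/
def cellIdx (τ : Cell) : Fin 3 → ℤ × ℤ :=
  if τ.2.2 then ![(τ.1, τ.2.1), (τ.1, τ.2.1 + 1), (τ.1 + 1, τ.2.1 + 1)]
  else ![(τ.1, τ.2.1), (τ.1 + 1, τ.2.1), (τ.1 + 1, τ.2.1 + 1)]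

theorem cellVert_eq (τ : Cell) (k : Fin 3) :
    cellVert o a b h τ k = latPt o a b h (cellIdx τ k).1 (cellIdx τ k).2 := by
  obtain ⟨i, j, c⟩ := τ
  cases c <;> fin_cases k <;> simp [cellVert, cellIdx, latPt] <;> module

theorem latS_cellVert (hc : cross a b ≠ 0) (hh : h ≠ 0) (τ : Cell) (k : Fin 3) :
    latS o a b h (cellVert o a b h τ k) = (cellIdx τ k).1 := by
  rw [cellVert_eq, latS_latPt hc hh]

theorem latT_cellVert (hc : cross a b ≠ 0) (hh : h ≠ 0) (τ : Cell) (k : Fin 3) :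
    latT o a b h (cellVert o a b h τ k) = (cellIdx τ k).2 := by
  rw [cellVert_eq, latT_latPt hc hh]

theorem cellVert_inj (hc : cross a b ≠ 0) (hh : h ≠ 0) {τ τ' : Cell} {k l : Fin 3} :
    cellVert o a b h τ k = cellVert o a b h τ' l ↔ cellIdx τ k = cellIdx τ' l := by
  constructor
  · intro e
    have h1 := congrArg (latS o a b h) e
    have h2 := congrArg (latT o a b h) e
    rw [latS_cellVert hc hh, latS_cellVert hc hh] at h1
    rw [latT_cellVert hc hh, latT_cellVert hc hh] at h2
    exact Prod.ext (by exact_mod_cast h1) (by exact_mod_cast h2)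
  · intro e; rw [cellVert_eq, cellVert_eq, e]

theorem mem_tri_cell (hc : cross a b ≠ 0) (hh : h ≠ 0) {τ : Cell} {x : Plane} :
    x ∈ tri (cellVert o a b h τ) ↔
      if τ.2.2 then 0 ≤ latS o a b h x - τ.1 ∧
        latS o a b h x - τ.1 ≤ latT o a b h x - τ.2.1 ∧ latT o a b h x - τ.2.1 ≤ 1
      else 0 ≤ latT o a b h x - τ.2.1 ∧
        latT o a b h x - τ.2.1 ≤ latS o a b h x - τ.1 ∧ latS o a b h x - τ.1 ≤ 1 := by
  obtain ⟨i, j, c⟩ := τ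
  constructor
  · intro hx
    obtain ⟨w, hw, hw1, rfl⟩ := mem_tri.1 hx
    rw [latS_comb hc hh hw1, latT_comb hc hh hw1]
    simp only [latS_cellVert hc hh, latT_cellVert hc hh]
    have h0 := hw 0; have h1 := hw 1; have h2 := hw 2
    obtain e : w 0 = 1 - w 1 - w 2 := by linarith
    rw [e] at h0 ⊢
    cases c <;> simp [cellIdx] <;> refine ⟨?_, ?_, ?_⟩ <;> ring_nf <;> linarith
  · intro hx
    rw [mem_tri]
    have e := latPt_latS_latT (o := o) hc hh x
    set s := latS o a b h x
    set t := latT o a b h x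
    cases c
    · simp only [Bool.false_eq_true, if_false] at hx
      refine ⟨![1 - (s - i), (s - i) - (t - j), t - j], ?_, ?_, ?_⟩
      · intro k; fin_cases k <;> simp <;> linarith [hx.1, hx.2.1, hx.2.2]
      · simp
      · rw [← e]; simp [cellVert, latPt]; module
    · simp only [if_true] at hx
      refine ⟨![1 - (t - j), (t - j) - (s - i), s - i], ?_, ?_, ?_⟩
      · intro k; fin_cases k <;> simp <;> linarith [hx.1, hx.2.1, hx.2.2]
      · simp
      · rw [← e]; simp [cellVert, latPt]; module

theorem exists_mem_tri_cell (hc : cross a b ≠ 0) (hh : h ≠ 0) (x : Plane) :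
    ∃ τ : Cell, x ∈ tri (cellVert o a b h τ) := by
  set i := ⌊latS o a b h x⌋
  set j := ⌊latT o a b h x⌋
  have h1 : (i : ℝ) ≤ _ := Int.floor_le (latS o a b h x)
  have h2 := Int.lt_floor_add_one (latS o a b h x)
  have h3 : (j : ℝ) ≤ _ := Int.floor_le (latT o a b h x)
  have h4 := Int.lt_floor_add_one (latT o a b h x)
  rcases le_total (latS o a b h x - i) (latT o a b h x - j) with h5 | h5
  · refine ⟨(i, j, true), (mem_tri_cell hc hh).2 ?_⟩
    simp only [if_true]; exact ⟨by linarith, h5, by linarith⟩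
  · refine ⟨(i, j, false), (mem_tri_cell hc hh).2 ?_⟩
    simp only [Bool.false_eq_true, if_false]; exact ⟨by linarith, h5, by linarith⟩

/-- The open star of a lattice point: the open hexagon formed by the six triangles around it. -/
def star (o a b : Plane) (h : ℝ) (p : ℤ × ℤ) : Set Plane :=
  {x | |latS o a b h x - p.1| < 1 ∧ |latT o a b h x - p.2| < 1 ∧
    |(latS o a b h x - p.1) - (latT o a b h x - p.2)| < 1}

theorem isOpen_star (p : ℤ × ℤ) : IsOpen (star o a b h p) := by
  have h1 := continuous_latS (o := o) (a := a) (b := b) (h := h)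
  have h2 := continuous_latT (o := o) (a := a) (b := b) (h := h)
  have e : star o a b h p = {x | |latS o a b h x - p.1| < 1} ∩ ({x | |latT o a b h x - p.2| < 1} ∩
      {x | |(latS o a b h x - p.1) - (latT o a b h x - p.2)| < 1}) := rfl
  rw [e]
  exact (isOpen_lt (by fun_prop) (by fun_prop)).inter
    ((isOpen_lt (by fun_prop) (by fun_prop)).inter (isOpen_lt (by fun_prop) (by fun_prop)))

theorem latPt_mem_star (hc : cross a b ≠ 0) (hh : h ≠ 0) (p : ℤ × ℤ) :
    latPt o a b h p.1 p.2 ∈ star o a b h p := by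
  simp [star, latS_latPt hc hh, latT_latPt hc hh]

/-- Only the six triangles around a lattice point meet its open star. -/
theorem exists_cellIdx_eq_of_mem_star (hc : cross a b ≠ 0) (hh : h ≠ 0) {τ : Cell} {x : Plane}
    {p : ℤ × ℤ} (hx : x ∈ tri (cellVert o a b h τ)) (hp : x ∈ star o a b h p) :
    ∃ k, cellIdx τ k = p := by
  rw [mem_tri_cell hc hh] at hx
  obtain ⟨i, j, c⟩ := τ
  obtain ⟨p, q⟩ := p
  obtain ⟨h1, h2, h3⟩ := hp
  rw [abs_lt] at h1 h2 h3
  set s := latS o a b h x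
  set t := latT o a b h x
  simp only at hx h1 h2 h3
  have bound : ∀ m n : ℤ, (m : ℝ) < n + 1 → m ≤ n := fun m n hm => by
    have : m < n + 1 := by exact_mod_cast hm
    omega
  cases c
  · simp only [Bool.false_eq_true, if_false] at hx
    obtain ⟨g1, g2, g3⟩ := hx
    have a1 : i ≤ p := bound _ _ (by linarith)
    have a2 : p ≤ i + 1 := bound _ _ (by push_cast; linarith)
    have a3 : j ≤ q := bound _ _ (by linarith)
    have a4 : q ≤ j + 1 := bound _ _ (by push_cast; linarith)
    have a5 : q - j ≤ p - i := bound _ _ (by push_cast; linarith)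
    by_cases b1 : p = i
    · refine ⟨0, ?_⟩; simp [cellIdx]; omega
    · by_cases b2 : q = j
      · refine ⟨1, ?_⟩; simp [cellIdx]; omega
      · refine ⟨2, ?_⟩; simp [cellIdx]; omega
  · simp only [if_true] at hx
    obtain ⟨g1, g2, g3⟩ := hx
    have a1 : i ≤ p := bound _ _ (by linarith)
    have a2 : p ≤ i + 1 := bound _ _ (by push_cast; linarith)
    have a3 : j ≤ q := bound _ _ (by linarith)
    have a4 : q ≤ j + 1 := bound _ _ (by push_cast; linarith)
    have a5 : p - i ≤ q - j := bound _ _ (by push_cast; linarith)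
    by_cases b1 : q = j
    · refine ⟨0, ?_⟩; simp [cellIdx]; omega
    · by_cases b2 : p = i
      · refine ⟨1, ?_⟩; simp [cellIdx]; omega
      · refine ⟨2, ?_⟩; simp [cellIdx]; omega

/-- The barycentric coordinate of a vertex is positive only in the open star of that vertex. -/
theorem mem_star_of_pos (hc : cross a b ≠ 0) (hh : h ≠ 0) {τ : Cell} {w : Fin 3 → ℝ}
    (hw : ∀ k, 0 ≤ w k) (hw1 : w 0 + w 1 + w 2 = 1) {k : Fin 3} (hk : 0 < w k) :
    w 0 • cellVert o a b h τ 0 + w 1 • cellVert o a b h τ 1 + w 2 • cellVert o a b h τ 2 ∈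
      star o a b h (cellIdx τ k) := by
  obtain ⟨i, j, c⟩ := τ
  have h0 := hw 0; have h1 := hw 1; have h2 := hw 2
  simp only [star, Set.mem_ofPred_eq, latS_comb hc hh hw1, latT_comb hc hh hw1,
    latS_cellVert hc hh, latT_cellVert hc hh]
  obtain e : w 0 = 1 - w 1 - w 2 := by linarith
  cases c <;> fin_cases k <;> simp [cellIdx, abs_lt] at hk ⊢ <;>
    refine ⟨⟨?_, ?_⟩, ⟨?_, ?_⟩, ⟨?_, ?_⟩⟩ <;> rw [e] at * <;> ring_nf at * <;> linarith

/-- Triangles of the uniform triangulation with a common point have a common vertex. -/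
theorem exists_common_vertex (hc : cross a b ≠ 0) (hh : h ≠ 0) {τ τ' : Cell} {x : Plane}
    (hx : x ∈ tri (cellVert o a b h τ)) (hx' : x ∈ tri (cellVert o a b h τ')) :
    ∃ k l, cellVert o a b h τ k = cellVert o a b h τ' l := by
  obtain ⟨w, hw, hw1, rfl⟩ := mem_tri.1 hx
  obtain ⟨k, hk⟩ : ∃ k, 0 < w k := by
    by_contra! H
    linarith [H 0, H 1, H 2]
  obtain ⟨l, hl⟩ := exists_cellIdx_eq_of_mem_star hc hh hx' (mem_star_of_pos hc hh hw hw1 hk)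
  exact ⟨k, l, (cellVert_inj hc hh).2 hl.symm⟩

theorem cellIdx_injective (τ : Cell) : Function.Injective (cellIdx τ) := by
  obtain ⟨i, j, c⟩ := τ
  intro k l
  cases c <;> fin_cases k <;> fin_cases l <;> simp [cellIdx]

/-- Two cells of the same orientation with two common vertices are equal. -/
theorem cell_eq_of_common_edge {τ τ' : Cell} (hτ : τ.2.2 = τ'.2.2) {k l k' l' : Fin 3}
    (hkl : k ≠ l) (hk : cellIdx τ k = cellIdx τ' k') (hl : cellIdx τ l = cellIdx τ' l') :
    τ = τ' := by
  obtain ⟨i, j, c⟩ := τ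
  obtain ⟨i', j', c'⟩ := τ'
  obtain rfl : c = c' := hτ
  cases c <;> fin_cases k <;> fin_cases l <;> first | exact absurd rfl hkl | skip
  all_goals
    fin_cases k' <;> fin_cases l' <;> simp [cellIdx] at hk hl ⊢ <;> omega

/-- Two cells with the same three vertices are equal. -/
theorem cell_eq_of_vertices {τ τ' : Cell} (H : ∀ k, ∃ l, cellIdx τ k = cellIdx τ' l) :
    τ = τ' := by
  by_cases hτ : τ.2.2 = τ'.2.2
  · obtain ⟨l, hl⟩ := H 0
    obtain ⟨m, hm⟩ := H 1
    exact cell_eq_of_common_edge hτ (by decide) hl hm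
  · exfalso
    obtain ⟨i, j, c⟩ := τ
    obtain ⟨i', j', c'⟩ := τ'
    obtain ⟨l, hl⟩ := H 0
    obtain ⟨m, hm⟩ := H 1
    obtain ⟨n, hn⟩ := H 2
    cases c <;> cases c' <;> first | exact hτ rfl | skip
    all_goals
      fin_cases l <;> fin_cases n <;> simp [cellIdx] at hl hn <;>
      fin_cases m <;> simp [cellIdx] at hm <;> omega

/-! ### Neighbourhoods of cells -/

/-- The cells of the uniform triangulation whose indices differ by at most `m` from those of
`τ`. -/
noncomputable def nearCells (m : ℕ) (τ : Cell) : Finset Cell :=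
  Finset.Icc (τ.1 - m) (τ.1 + m) ×ˢ Finset.Icc (τ.2.1 - m) (τ.2.1 + m) ×ˢ Finset.univ

theorem mem_nearCells {m : ℕ} {τ τ' : Cell} :
    τ' ∈ nearCells m τ ↔ |τ'.1 - τ.1| ≤ m ∧ |τ'.2.1 - τ.2.1| ≤ m := by
  simp only [nearCells, Finset.mem_product, Finset.mem_Icc, Finset.mem_univ, and_true, abs_le]
  constructor <;> rintro ⟨⟨h1, h2⟩, h3, h4⟩ <;> refine ⟨⟨?_, ?_⟩, ?_, ?_⟩ <;> linarith

theorem mem_nearCells_comm {m : ℕ} {τ τ' : Cell} : τ' ∈ nearCells m τ ↔ τ ∈ nearCells m τ' := by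
  rw [mem_nearCells, mem_nearCells, abs_sub_comm, abs_sub_comm τ'.2.1]

theorem self_mem_nearCells (m : ℕ) (τ : Cell) : τ ∈ nearCells m τ := by
  rw [mem_nearCells]; simp

theorem nearCells_trans {m n : ℕ} {τ τ' τ'' : Cell} (h1 : τ' ∈ nearCells m τ)
    (h2 : τ'' ∈ nearCells n τ') : τ'' ∈ nearCells (m + n) τ := by
  rw [mem_nearCells] at *
  simp only [abs_le] at *
  push_cast
  refine ⟨⟨?_, ?_⟩, ?_, ?_⟩ <;> linarith [h1.1.1, h1.1.2, h1.2.1, h1.2.2, h2.1.1, h2.1.2, h2.2.1,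
    h2.2.2]

theorem nearCells_mono {m n : ℕ} (hmn : m ≤ n) (τ : Cell) : nearCells m τ ⊆ nearCells n τ := by
  intro τ' h
  rw [mem_nearCells] at *
  have : (m : ℤ) ≤ n := by exact_mod_cast hmn
  exact ⟨h.1.trans this, h.2.trans this⟩

/-- The number of cells in `nearCells m τ`. -/
def nearCount (m : ℕ) : ℕ := (2 * m + 1) * ((2 * m + 1) * 2)

theorem card_nearCells (m : ℕ) (τ : Cell) : (nearCells m τ).card = nearCount m := by
  simp only [nearCells, Finset.card_product, Int.card_Icc, Finset.card_univ, Fintype.card_bool,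
    nearCount]
  congr 1
  · omega
  · congr 1; omega

theorem latS_sub_mem {τ : Cell} {x : Plane} (hc : cross a b ≠ 0) (hh : h ≠ 0)
    (hx : x ∈ tri (cellVert o a b h τ)) : 0 ≤ latS o a b h x - τ.1 ∧
      latS o a b h x - τ.1 ≤ 1 ∧ 0 ≤ latT o a b h x - τ.2.1 ∧ latT o a b h x - τ.2.1 ≤ 1 := by
  rw [mem_tri_cell hc hh] at hx
  split_ifs at hx <;> refine ⟨?_, ?_, ?_, ?_⟩ <;> linarith [hx.1, hx.2.1, hx.2.2]

/-- Triangles with points at a distance `O(h)` have neighbouring indices. -/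
theorem mem_nearCells_of_dist (hc : cross a b ≠ 0) (hh : 0 < h) {τ τ' : Cell} {x y : Plane}
    (hx : x ∈ tri (cellVert o a b h τ)) (hy : y ∈ tri (cellVert o a b h τ')) {m : ℕ}
    (hm : 2 * (‖a‖ + ‖b‖) / |cross a b| * (h⁻¹ * ‖x - y‖) + 1 ≤ m) : τ' ∈ nearCells m τ := by
  obtain ⟨h1, h2, h3, h4⟩ := latS_sub_mem hc hh.ne' hx
  obtain ⟨g1, g2, g3, g4⟩ := latS_sub_mem hc hh.ne' hy
  have e1 := abs_le.1 (abs_latS_sub_le (o := o) hc hh x y)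
  have e2 := abs_le.1 (abs_latT_sub_le (o := o) hc hh x y)
  rw [mem_nearCells]
  constructor
  · have : |((τ'.1 - τ.1 : ℤ) : ℝ)| ≤ (m : ℤ) := by
      push_cast; rw [abs_le]; constructor <;> linarith [e1.1, e1.2]
    exact_mod_cast this
  · have : |((τ'.2.1 - τ.2.1 : ℤ) : ℝ)| ≤ (m : ℤ) := by
      push_cast; rw [abs_le]; constructor <;> linarith [e2.1, e2.2]
    exact_mod_cast this

theorem mem_nearCells_of_common_point (hc : cross a b ≠ 0) (hh : 0 < h) {τ τ' : Cell} {x : Plane}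
    (hx : x ∈ tri (cellVert o a b h τ)) (hy : x ∈ tri (cellVert o a b h τ')) :
    τ' ∈ nearCells 1 τ :=
  mem_nearCells_of_dist hc hh hx hy (by simp)

theorem dist_le_of_mem_tri_cell {τ : Cell} (hh : 0 < h) {x y : Plane}
    (hx : x ∈ tri (cellVert o a b h τ)) (hy : y ∈ tri (cellVert o a b h τ)) :
    ‖x - y‖ ≤ 2 * (‖a‖ + ‖b‖) * h := by
  have key : ∀ z ∈ tri (cellVert o a b h τ), z ∈
      Metric.closedBall (cellVert o a b h τ 0) ((‖a‖ + ‖b‖) * h) := by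
    intro z hz
    refine tri_subset (convex_closedBall _ _) (fun k => ?_) hz
    have ha : ‖h • a‖ ≤ (‖a‖ + ‖b‖) * h := by
      rw [norm_smul, Real.norm_eq_abs, abs_of_pos hh]; nlinarith [norm_nonneg a, norm_nonneg b]
    have hb : ‖h • b‖ ≤ (‖a‖ + ‖b‖) * h := by
      rw [norm_smul, Real.norm_eq_abs, abs_of_pos hh]; nlinarith [norm_nonneg a, norm_nonneg b]
    have hab : ‖h • (a + b)‖ ≤ (‖a‖ + ‖b‖) * h := by
      rw [norm_smul, Real.norm_eq_abs, abs_of_pos hh]; nlinarith [norm_add_le a b]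
    have h0 : 0 ≤ (‖a‖ + ‖b‖) * h := by positivity
    rw [mem_closedBall_iff_norm]
    obtain ⟨i, j, c⟩ := τ
    cases c <;> fin_cases k <;> simpa [cellVert, -smul_add] using by assumption
  have h1 := mem_closedBall_iff_norm.1 (key x hx)
  have h2 := mem_closedBall_iff_norm.1 (key y hy)
  calc ‖x - y‖ = ‖(x - cellVert o a b h τ 0) - (y - cellVert o a b h τ 0)‖ := by congr 1; abel
    _ ≤ _ := norm_sub_le _ _
    _ ≤ _ := by linarith

theorem interior_tri_cell_nonempty (hc : cross a b ≠ 0) (hh : h ≠ 0) (τ : Cell) :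
    (interior (tri (cellVert o a b h τ))).Nonempty := by
  have c1 := continuous_latS (o := o) (a := a) (b := b) (h := h)
  have c2 := continuous_latT (o := o) (a := a) (b := b) (h := h)
  obtain ⟨i, j, c⟩ := τ
  cases c
  · refine ⟨latPt o a b h (i + 2/3) (j + 1/3), mem_interior.2
      ⟨{x | 0 < latT o a b h x - j} ∩ ({x | latT o a b h x - j < latS o a b h x - i} ∩
        {x | latS o a b h x - i < 1}), ?_, ?_, ?_⟩⟩
    · rintro x ⟨h1, h2, h3⟩
      rw [mem_tri_cell hc hh]
      exact ⟨le_of_lt h1, le_of_lt h2, le_of_lt h3⟩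
    · exact (isOpen_lt (by fun_prop) (by fun_prop)).inter
        ((isOpen_lt (by fun_prop) (by fun_prop)).inter (isOpen_lt (by fun_prop) (by fun_prop)))
    · simp only [Set.mem_inter_iff, Set.mem_ofPred_eq, latS_latPt hc hh, latT_latPt hc hh]
      refine ⟨?_, ?_, ?_⟩ <;> linarith
  · refine ⟨latPt o a b h (i + 1/3) (j + 2/3), mem_interior.2
      ⟨{x | 0 < latS o a b h x - i} ∩ ({x | latS o a b h x - i < latT o a b h x - j} ∩
        {x | latT o a b h x - j < 1}), ?_, ?_, ?_⟩⟩
    · rintro x ⟨h1, h2, h3⟩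
      rw [mem_tri_cell hc hh]
      exact ⟨le_of_lt h1, le_of_lt h2, le_of_lt h3⟩
    · exact (isOpen_lt (by fun_prop) (by fun_prop)).inter
        ((isOpen_lt (by fun_prop) (by fun_prop)).inter (isOpen_lt (by fun_prop) (by fun_prop)))
    · simp only [Set.mem_inter_iff, Set.mem_ofPred_eq, latS_latPt hc hh, latT_latPt hc hh]
      refine ⟨?_, ?_, ?_⟩ <;> linarith

/-- All triangles of the uniform triangulation are translates of each other or of their point
reflections, hence have the same area. -/
theorem volume_tri_cell (hc : cross a b ≠ 0) (hh : h ≠ 0) (τ τ' : Cell) :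
    volume (tri (cellVert o a b h τ)) = volume (tri (cellVert o a b h τ')) := by
  have hS : ∀ x u : Plane, latS o a b h (x - u) = latS o a b h x - cross u b / (h * cross a b) := by
    intro x u; unfold latS; rw [← sub_div]; congr 1; simp [cross]; ring
  have hT : ∀ x u : Plane, latT o a b h (x - u) = latT o a b h x - cross a u / (h * cross a b) := by
    intro x u; unfold latT; rw [← sub_div]; congr 1; simp [cross]; ring
  have key : ∀ τ : Cell, volume (tri (cellVert o a b h τ)) =
      volume (tri (cellVert o a b h (0, 0, false))) := by
    rintro ⟨i, j, c⟩
    cases c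
    · have e : tri (cellVert o a b h (i, j, false)) =
          (fun x => x - h • ((i : ℝ) • a + (j : ℝ) • b)) ⁻¹'
            tri (cellVert o a b h (0, 0, false)) := by
        ext x
        have e1 : cross (h • ((i : ℝ) • a + (j : ℝ) • b)) b / (h * cross a b) = i := by
          rw [div_eq_iff (mul_ne_zero hh hc)]; simp [cross]; ring
        have e2 : cross a (h • ((i : ℝ) • a + (j : ℝ) • b)) / (h * cross a b) = j := by
          rw [div_eq_iff (mul_ne_zero hh hc)]; simp [cross]; ring
        rw [Set.mem_preimage, mem_tri_cell hc hh, mem_tri_cell hc hh, hS, hT, e1, e2]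
        simp
      rw [e]
      exact (measurePreserving_sub_right volume _).measure_preimage
        (isClosed_tri _).measurableSet.nullMeasurableSet
    · set c := latPt o a b h (i + 1) (j + 1) + o with hcdef
      have e : tri (cellVert o a b h (i, j, true)) =
          (fun x => c - x) ⁻¹' tri (cellVert o a b h (0, 0, false)) := by
        ext x
        have e1 : latS o a b h (c - x) = i + 1 - latS o a b h x := by
          unfold latS
          rw [eq_sub_iff_add_eq, ← add_div, div_eq_iff (mul_ne_zero hh hc)]
          simp [cross, hcdef, latPt]; ring
        have e2 : latT o a b h (c - x) = j + 1 - latT o a b h x := by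
          unfold latT
          rw [eq_sub_iff_add_eq, ← add_div, div_eq_iff (mul_ne_zero hh hc)]
          simp [cross, hcdef, latPt]; ring
        rw [Set.mem_preimage, mem_tri_cell hc hh, mem_tri_cell hc hh, e1, e2]
        simp only [if_true, Bool.false_eq_true, if_false, Int.cast_zero, sub_zero]
        constructor <;> rintro ⟨h1, h2, h3⟩ <;> refine ⟨?_, ?_, ?_⟩ <;> linarith
      rw [e]
      exact (Measure.measurePreserving_sub_left volume _).measure_preimage
        (isClosed_tri _).measurableSet.nullMeasurableSet
  rw [key τ, key τ']

end Lattice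

/-! ### The pieces of a cut element -/

theorem tri_congr {V W : Fin 3 → Plane} (H : Set.range V = Set.range W) : tri V = tri W := by
  rw [tri, tri, H]

theorem tri_rotate (A B C : Plane) : tri ![A, B, C] = tri ![B, C, A] :=
  tri_congr (by ext x; simp; tauto)

theorem tri_swap (A B C : Plane) : tri ![A, B, C] = tri ![A, C, B] :=
  tri_congr (by ext x; simp; tauto)

theorem tri_eq_rotate (V : Fin 3 → Plane) (k : Fin 3) :
    tri V = tri ![V k, V (k + 1), V (k + 2)] := by
  refine tri_congr ?_
  fin_cases k <;> ext x <;> simp [Fin.exists_fin_succ] <;> tauto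

/-- A triangle is cut into two by the line through a vertex and a point of the opposite side. -/
theorem tri_subset_union {A B C : Plane} {s : ℝ} (hs : 0 < s ∧ s < 1) :
    tri ![A, B, C] ⊆ tri ![A, AffineMap.lineMap A B s, C] ∪
      tri ![AffineMap.lineMap A B s, B, C] := by
  intro x hx
  obtain ⟨w, hw, hw1, rfl⟩ := mem_tri.1 hx
  have h0 := hw 0; have h1 := hw 1; have h2 := hw 2
  have hs' : 0 < 1 - s := by linarith
  rw [AffineMap.lineMap_apply_module]
  rcases le_total (w 1 * (1 - s)) (w 0 * s) with H | H
  · refine Or.inl (mem_tri.2 ⟨![w 0 - w 1 * (1 - s) / s, w 1 / s, w 2], ?_, ?_, ?_⟩)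
    · intro k; fin_cases k
      · simp only [Fin.zero_eta, Matrix.cons_val_zero, sub_nonneg]
        rw [div_le_iff₀ hs.1]; exact H
      · exact div_nonneg h1 hs.1.le
      · exact h2
    · have e : w 1 / s - w 1 * (1 - s) / s = w 1 := by field_simp [hs.1.ne']; ring
      simp; linarith
    · ext k; simp; field_simp [hs.1.ne']; ring
  · refine Or.inr (mem_tri.2 ⟨![w 0 / (1 - s), w 1 - w 0 * s / (1 - s), w 2], ?_, ?_, ?_⟩)
    · intro k; fin_cases k
      · exact div_nonneg h0 hs'.le
      · simp only [Fin.mk_one, Matrix.cons_val_one, Matrix.cons_val_zero, sub_nonneg]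
        rw [div_le_iff₀ hs']; exact H
      · exact h2
    · have e : w 0 / (1 - s) - w 0 * s / (1 - s) = w 0 := by field_simp [hs'.ne']
      simp; linarith
    · ext k; simp; field_simp [hs'.ne']; ring

/-- The intersection points of a cut lie strictly inside the edges. -/
def Cut.Proper : Cut → Prop
  | .regular _ => True
  | .corner _ s t _ _ => (0 < s ∧ s < 1) ∧ (0 < t ∧ t < 1)
  | .through _ t _ => 0 < t ∧ t < 1

theorem Cut.Fits.proper {G : InterfaceDomain} {V : Fin 3 → Plane} {c : Cut} (hc : c.Fits G V) :
    c.Proper := by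
  cases c with
  | regular => trivial
  | corner => exact ⟨hc.1, hc.2.1⟩
  | through => exact hc.1

theorem Cut.mem_pieces_regular {σ : Side} {τ : Cell} {V : Fin 3 → Plane} {T : FineTri} :
    T ∈ (Cut.regular σ).pieces τ V ↔ T = ⟨τ, σ, V⟩ := by simp [Cut.pieces]

theorem Cut.mem_pieces_corner_true {k : Fin 3} {s t : ℝ} {σ : Side} {τ : Cell}
    {V : Fin 3 → Plane} {T : FineTri} : T ∈ (Cut.corner k s t true σ).pieces τ V ↔
      T = ⟨τ, σ, ![V k, AffineMap.lineMap (V k) (V (k + 1)) s,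
        AffineMap.lineMap (V k) (V (k + 2)) t]⟩ ∨
      T = ⟨τ, σ.other, ![V (k + 1), V (k + 2), AffineMap.lineMap (V k) (V (k + 2)) t]⟩ ∨
      T = ⟨τ, σ.other, ![V (k + 1), AffineMap.lineMap (V k) (V (k + 2)) t,
        AffineMap.lineMap (V k) (V (k + 1)) s]⟩ := by
  simp [Cut.pieces, Cut.z₄, Cut.z₅]

theorem Cut.mem_pieces_corner_false {k : Fin 3} {s t : ℝ} {σ : Side} {τ : Cell}
    {V : Fin 3 → Plane} {T : FineTri} : T ∈ (Cut.corner k s t false σ).pieces τ V ↔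
      T = ⟨τ, σ, ![V k, AffineMap.lineMap (V k) (V (k + 1)) s,
        AffineMap.lineMap (V k) (V (k + 2)) t]⟩ ∨
      T = ⟨τ, σ.other, ![V (k + 1), V (k + 2), AffineMap.lineMap (V k) (V (k + 1)) s]⟩ ∨
      T = ⟨τ, σ.other, ![V (k + 2), AffineMap.lineMap (V k) (V (k + 2)) t,
        AffineMap.lineMap (V k) (V (k + 1)) s]⟩ := by
  simp [Cut.pieces, Cut.z₄, Cut.z₅]

theorem Cut.mem_pieces_through {k : Fin 3} {t : ℝ} {σ : Side} {τ : Cell}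
    {V : Fin 3 → Plane} {T : FineTri} : T ∈ (Cut.through k t σ).pieces τ V ↔
      T = ⟨τ, σ, ![V k, V (k + 1), AffineMap.lineMap (V (k + 1)) (V (k + 2)) t]⟩ ∨
      T = ⟨τ, σ.other, ![V k, AffineMap.lineMap (V (k + 1)) (V (k + 2)) t, V (k + 2)]⟩ := by
  simp [Cut.pieces, Cut.z₅]

/-- `p` is a vertex of one of the pieces of a cut element. -/
def Cut.IsVertex (c : Cut) (τ : Cell) (V : Fin 3 → Plane) (p : Plane) : Prop :=
  ∃ T ∈ c.pieces τ V, ∃ k, T.vert k = p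

/-- `p` is a vertex of one of the pieces on the side `σ` of a cut element. -/
def Cut.IsNode (c : Cut) (τ : Cell) (V : Fin 3 → Plane) (σ : Side) (p : Plane) : Prop :=
  ∃ T ∈ c.pieces τ V, T.side = σ ∧ ∃ k, T.vert k = p

theorem lineMap_mem_tri (V : Fin 3 → Plane) (i j : Fin 3) {s : ℝ} (hs : 0 < s ∧ s < 1) :
    AffineMap.lineMap (V i) (V j) s ∈ tri V := by
  refine segment_subset_tri V i j ?_
  rw [segment_eq_image_lineMap]
  exact ⟨s, ⟨hs.1.le, hs.2.le⟩, rfl⟩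

section Pieces

variable {c : Cut} {τ : Cell} {V : Fin 3 → Plane}

theorem Cut.cell_of_mem_pieces {T : FineTri} (hT : T ∈ c.pieces τ V) : T.cell = τ := by
  rcases c with σ | ⟨k, s, t, _ | _, σ⟩ | ⟨k, t, σ⟩
  · rw [Cut.mem_pieces_regular] at hT; rw [hT]
  · rw [Cut.mem_pieces_corner_false] at hT; rcases hT with rfl | rfl | rfl <;> rfl
  · rw [Cut.mem_pieces_corner_true] at hT; rcases hT with rfl | rfl | rfl <;> rfl
  · rw [Cut.mem_pieces_through] at hT; rcases hT with rfl | rfl <;> rfl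

theorem Cut.card_pieces_le : (c.pieces τ V).card ≤ 3 := by
  classical
  rcases c with σ | ⟨k, s, t, _ | _, σ⟩ | ⟨k, t, σ⟩
  · simp [Cut.pieces]
  · simp only [Cut.pieces, Bool.false_eq_true, if_false]; exact Finset.card_le_three
  · simp only [Cut.pieces, if_true]; exact Finset.card_le_three
  · simp only [Cut.pieces]; exact Finset.card_le_two.trans (by norm_num)

theorem Cut.vert_mem_tri_of_mem_pieces (hc : c.Proper) {T : FineTri} (hT : T ∈ c.pieces τ V)
    (k : Fin 3) : T.vert k ∈ tri V := by
  rcases c with σ | ⟨i, s, t, _ | _, σ⟩ | ⟨i, t, σ⟩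
  · rw [Cut.mem_pieces_regular] at hT; rw [hT]; exact vert_mem_tri V k
  · rw [Cut.mem_pieces_corner_false] at hT
    have h1 := lineMap_mem_tri V i (i + 1) hc.1
    have h2 := lineMap_mem_tri V i (i + 2) hc.2
    rcases hT with rfl | rfl | rfl <;> fin_cases k <;> first | assumption | exact vert_mem_tri V _
  · rw [Cut.mem_pieces_corner_true] at hT
    have h1 := lineMap_mem_tri V i (i + 1) hc.1
    have h2 := lineMap_mem_tri V i (i + 2) hc.2
    rcases hT with rfl | rfl | rfl <;> fin_cases k <;> first | assumption | exact vert_mem_tri V _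
  · rw [Cut.mem_pieces_through] at hT
    have h1 := lineMap_mem_tri V (i + 1) (i + 2) hc
    rcases hT with rfl | rfl <;> fin_cases k <;> first | assumption | exact vert_mem_tri V _

theorem Cut.tri_subset_of_mem_pieces (hc : c.Proper) {T : FineTri} (hT : T ∈ c.pieces τ V) :
    tri T.vert ⊆ tri V :=
  tri_subset (convex_tri V) fun k => Cut.vert_mem_tri_of_mem_pieces hc hT k

/-- Any two pieces of an element have a common vertex. -/
theorem Cut.exists_common_vertex {T T' : FineTri} (hT : T ∈ c.pieces τ V)
    (hT' : T' ∈ c.pieces τ V) : ∃ k l, T.vert k = T'.vert l := by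
  rcases c with σ | ⟨i, s, t, _ | _, σ⟩ | ⟨i, t, σ⟩
  · rw [Cut.mem_pieces_regular] at hT hT'; rw [hT, hT']; exact ⟨0, 0, rfl⟩
  · rw [Cut.mem_pieces_corner_false] at hT hT'
    rcases hT with rfl | rfl | rfl
    · rcases hT' with rfl | rfl | rfl
      exacts [⟨1, 1, rfl⟩, ⟨1, 2, rfl⟩, ⟨1, 2, rfl⟩]
    · rcases hT' with rfl | rfl | rfl
      exacts [⟨2, 1, rfl⟩, ⟨2, 2, rfl⟩, ⟨2, 2, rfl⟩]
    · rcases hT' with rfl | rfl | rfl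
      exacts [⟨2, 1, rfl⟩, ⟨2, 2, rfl⟩, ⟨2, 2, rfl⟩]
  · rw [Cut.mem_pieces_corner_true] at hT hT'
    rcases hT with rfl | rfl | rfl
    · rcases hT' with rfl | rfl | rfl
      exacts [⟨2, 2, rfl⟩, ⟨2, 2, rfl⟩, ⟨2, 1, rfl⟩]
    · rcases hT' with rfl | rfl | rfl
      exacts [⟨2, 2, rfl⟩, ⟨2, 2, rfl⟩, ⟨2, 1, rfl⟩]
    · rcases hT' with rfl | rfl | rfl
      exacts [⟨1, 2, rfl⟩, ⟨1, 2, rfl⟩, ⟨1, 1, rfl⟩]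
  · rw [Cut.mem_pieces_through] at hT hT'
    rcases hT with rfl | rfl <;> rcases hT' with rfl | rfl <;> exact ⟨0, 0, rfl⟩

theorem Cut.tri_subset_iUnion_pieces (hc : c.Proper) :
    tri V ⊆ ⋃ T ∈ c.pieces τ V, tri T.vert := by
  intro x hx
  simp only [Set.mem_iUnion, exists_prop]
  rcases c with σ | ⟨i, s, t, _ | _, σ⟩ | ⟨i, t, σ⟩
  · exact ⟨_, Cut.mem_pieces_regular.2 rfl, hx⟩
  · simp only [Cut.mem_pieces_corner_false]
    rw [tri_eq_rotate V i] at hx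
    rcases tri_subset_union hc.1 hx with H | H
    · rw [tri_swap] at H
      rcases tri_subset_union hc.2 H with H | H
      · exact ⟨_, Or.inl rfl, by rw [tri_swap]; exact H⟩
      · exact ⟨_, Or.inr (Or.inr rfl), by rw [tri_rotate, tri_swap]; exact H⟩
    · exact ⟨_, Or.inr (Or.inl rfl), by rw [← tri_rotate]; exact H⟩
  · simp only [Cut.mem_pieces_corner_true]
    rw [tri_eq_rotate V i, tri_swap] at hx
    rcases tri_subset_union hc.2 hx with H | H
    · rw [tri_swap] at H
      rcases tri_subset_union hc.1 H with H | H
      · exact ⟨_, Or.inl rfl, H⟩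
      · exact ⟨_, Or.inr (Or.inr rfl), by rw [← tri_rotate]; exact H⟩
    · exact ⟨_, Or.inr (Or.inl rfl), by rw [tri_rotate, tri_rotate, tri_swap]; exact H⟩
  · simp only [Cut.mem_pieces_through]
    rw [tri_eq_rotate V i, tri_rotate] at hx
    rcases tri_subset_union hc hx with H | H
    · exact ⟨_, Or.inl rfl, by rw [tri_rotate]; exact H⟩
    · exact ⟨_, Or.inr rfl, by rw [tri_rotate]; exact H⟩

theorem Cut.isVertex_vert (c : Cut) (τ : Cell) (V : Fin 3 → Plane) (j : Fin 3) :
    c.IsVertex τ V (V j) := by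
  have key : ∀ i : Fin 3, j = i ∨ j = i + 1 ∨ j = i + 2 := by revert j; decide
  rcases c with σ | ⟨i, s, t, _ | _, σ⟩ | ⟨i, t, σ⟩
  · exact ⟨_, Cut.mem_pieces_regular.2 rfl, j, rfl⟩
  · simp only [Cut.IsVertex, Cut.mem_pieces_corner_false]
    rcases key i with rfl | rfl | rfl
    exacts [⟨_, Or.inl rfl, 0, rfl⟩, ⟨_, Or.inr (Or.inl rfl), 0, rfl⟩,
      ⟨_, Or.inr (Or.inl rfl), 1, rfl⟩]
  · simp only [Cut.IsVertex, Cut.mem_pieces_corner_true]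
    rcases key i with rfl | rfl | rfl
    exacts [⟨_, Or.inl rfl, 0, rfl⟩, ⟨_, Or.inr (Or.inl rfl), 0, rfl⟩,
      ⟨_, Or.inr (Or.inl rfl), 1, rfl⟩]
  · simp only [Cut.IsVertex, Cut.mem_pieces_through]
    rcases key i with rfl | rfl | rfl
    exacts [⟨_, Or.inl rfl, 0, rfl⟩, ⟨_, Or.inl rfl, 1, rfl⟩, ⟨_, Or.inr rfl, 2, rfl⟩]

end Pieces

/-! ### The immersed finite element functions on one element -/

/-- The interface conditions bound the gradients on the two sides by each other. The jump `p - q`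
of the gradient is normal to the discrete interface, and testing the flux condition with it gives
`(B x - b y) (x - y) ≤ 0` for the norms `x`, `y` of the gradients. -/
theorem norm_le_of_flux {E : Type*} [NormedAddCommGroup E] [InnerProductSpace ℝ E] {p q : E}
    {B b : ℝ} (hB : 0 < B) (hb : 0 < b) (H : B * inner ℝ p (p - q) = b * inner ℝ q (p - q)) :
    ‖p‖ ≤ max 1 (b / B) * ‖q‖ := by
  rw [inner_sub_right, inner_sub_right, real_inner_self_eq_norm_sq, real_inner_self_eq_norm_sq,
    real_inner_comm p q] at H
  have hZ := real_inner_le_norm p q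
  by_contra! hlt
  have h1 : ‖q‖ < ‖p‖ := lt_of_le_of_lt (le_mul_of_one_le_left (norm_nonneg q) (le_max_left _ _)) hlt
  have h2 : b / B * ‖q‖ < ‖p‖ :=
    lt_of_le_of_lt (mul_le_mul_of_nonneg_right (le_max_right _ _) (norm_nonneg q)) hlt
  have h3 : b * ‖q‖ < B * ‖p‖ := by
    rw [div_mul_eq_mul_div, div_lt_iff₀ hB] at h2; linarith
  have h4 : 0 < (B * ‖p‖ - b * ‖q‖) * (‖p‖ - ‖q‖) := mul_pos (by linarith) (by linarith)
  have h5 : (B + b) * inner ℝ p q ≤ (B + b) * (‖p‖ * ‖q‖) :=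
    mul_le_mul_of_nonneg_left hZ (by positivity)
  have H' : B * (‖p‖ ^ 2 - inner ℝ p q) = b * (inner ℝ p q - ‖q‖ ^ 2) := by
    exact H
  nlinarith

/-- On one element, `w` is affine on the pieces, with the constant term `α σ` and the gradient `g σ`
on the side `σ`, and the gradients on the two sides bound each other up to the factor `ρ`. -/
def ComparablyAffine (c : Cut) (τ : Cell) (V : Fin 3 → Plane) (ρ : ℝ) (w : Plane → ℝ)
    (α : Side → ℝ) (g : Side → Plane) : Prop :=
  (∀ T ∈ c.pieces τ V, ∀ x ∈ tri T.vert, w x = α T.side + inner ℝ (g T.side) x) ∧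
    ∀ σ σ', ‖g σ‖ ≤ ρ * ‖g σ'‖

theorem CutMesh.LocalIFE.comparablyAffine {G : InterfaceDomain} {a b : Plane} {h : ℝ}
    {M : CutMesh G a b h} {βm βp β₀ β₁ : ℝ} {τ : Cell} {w : Plane → ℝ}
    (hβ₀ : 0 < β₀) (hm : (M.cut τ).IsInterface → β₀ ≤ βm ∧ βm ≤ β₁)
    (hp : (M.cut τ).IsInterface → β₀ ≤ βp ∧ βp ≤ β₁)
    (hw : M.LocalIFE βm βp τ w) :
    ∃ α g, ComparablyAffine (M.cut τ) τ (M.vert τ) (max 1 (β₁ / β₀)) w α g := by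
  have hρ : ∀ x : Plane, ‖x‖ ≤ max 1 (β₁ / β₀) * ‖x‖ := fun x =>
    le_mul_of_one_le_left (norm_nonneg x) (le_max_left _ _)
  by_cases hI : (M.cut τ).IsInterface
  · obtain ⟨α, g, h1, h2, h3⟩ := hw.1 hI
    obtain ⟨m1, m2⟩ := hm hI
    obtain ⟨p1, p2⟩ := hp hI
    refine ⟨α, g, h1, ?_⟩
    have e4 := h2 _ (Or.inl rfl)
    have e5 := h2 _ (Or.inr rfl)
    have hn : inner ℝ (g .plus - g .minus)
        ((M.cut τ).z₅ (M.vert τ) - (M.cut τ).z₄ (M.vert τ)) = 0 := by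
      rw [inner_sub_left, inner_sub_right, inner_sub_right]; linarith
    have e := h3 _ hn
    have hpm : ‖g .plus‖ ≤ max 1 (β₁ / β₀) * ‖g .minus‖ := by
      refine (norm_le_of_flux (by linarith : 0 < βp) (by linarith : 0 < βm) e).trans ?_
      refine mul_le_mul_of_nonneg_right (max_le_max le_rfl ?_) (norm_nonneg _)
      exact div_le_div₀ (by linarith) m2 hβ₀ p1
    have hmp : ‖g .minus‖ ≤ max 1 (β₁ / β₀) * ‖g .plus‖ := by
      refine (norm_le_of_flux (q := g .plus) (by linarith : 0 < βm) (by linarith : 0 < βp) ?_).trans ?_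
      · rw [← neg_sub, inner_neg_right, inner_neg_right, mul_neg, mul_neg, e]
      refine mul_le_mul_of_nonneg_right (max_le_max le_rfl ?_) (norm_nonneg _)
      exact div_le_div₀ (by linarith) p2 hβ₀ m1
    intro σ σ'
    cases σ <;> cases σ' <;> first | exact hρ _ | assumption
  · obtain ⟨α, g, h1⟩ := hw.2 hI
    refine ⟨fun _ => α, fun _ => g, fun T hT x hx => ?_, fun _ _ => hρ _⟩
    cases hcut : M.cut τ with
    | regular σ => rw [hcut, Cut.mem_pieces_regular] at hT; subst hT; exact h1 x hx
    | corner => rw [hcut] at hI; exact absurd trivial hI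
    | through => rw [hcut] at hI; exact absurd trivial hI

namespace ComparablyAffine

variable {c : Cut} {τ : Cell} {V : Fin 3 → Plane} {ρ : ℝ} {w : Plane → ℝ}
  {α : Side → ℝ} {g : Side → Plane}

/-- The oscillation over the vertices of the pieces of an element. -/
theorem abs_sub_le (H : ComparablyAffine c τ V ρ w α g) (hc : c.Proper) {D m : ℝ} (hm : 0 ≤ m)
    (hD : ∀ x ∈ tri V, ∀ y ∈ tri V, ‖x - y‖ ≤ D) (hg : ∀ σ, ‖g σ‖ ≤ m) {p q : Plane}
    (hp : c.IsVertex τ V p) (hq : c.IsVertex τ V q) : |w p - w q| ≤ 2 * D * m := by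
  have key : ∀ T ∈ c.pieces τ V, ∀ k l, |w (T.vert k) - w (T.vert l)| ≤ D * m := by
    intro T hT k l
    rw [H.1 T hT _ (vert_mem_tri _ k), H.1 T hT _ (vert_mem_tri _ l)]
    have e : α T.side + inner ℝ (g T.side) (T.vert k) -
        (α T.side + inner ℝ (g T.side) (T.vert l)) =
        inner ℝ (g T.side) (T.vert k - T.vert l) := by rw [inner_sub_right]; ring
    rw [e]
    refine (abs_real_inner_le_norm _ _).trans ?_
    rw [mul_comm D]
    exact mul_le_mul (hg _) (hD _ (Cut.vert_mem_tri_of_mem_pieces hc hT k) _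
      (Cut.vert_mem_tri_of_mem_pieces hc hT l)) (norm_nonneg _) hm
  obtain ⟨T, hT, k, rfl⟩ := hp
  obtain ⟨T', hT', l, rfl⟩ := hq
  obtain ⟨i, j, hij⟩ := Cut.exists_common_vertex hT hT'
  have h1 := key T hT k i
  have h2 := key T' hT' j l
  rw [← hij] at h2
  calc |w (T.vert k) - w (T'.vert l)| = |(w (T.vert k) - w (T.vert i)) +
        (w (T.vert i) - w (T'.vert l))| := by congr 1; ring
    _ ≤ _ := abs_add_le _ _
    _ ≤ 2 * D * m := by linarith

/-- The Dirichlet energy of an element controls the gradients on both of its sides. -/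
theorem sq_mul_volume_le (H : ComparablyAffine c τ V ρ w α g) (hc : c.Proper) {m : ℝ}
    (hm : ∀ σ, m ≤ ‖g σ‖) :
    ENNReal.ofReal m ^ 2 * volume (tri V) ≤
      eLpNorm (fderiv ℝ w) 2 (volume.restrict (tri V)) ^ 2 := by
  have hfd : ∀ᵐ x ∂(volume.restrict (tri V)), ENNReal.ofReal m ^ 2 ≤ ‖fderiv ℝ w x‖ₑ ^ 2 := by
    have hfr : ∀ᵐ x ∂(volume : Measure Plane), ∀ T ∈ c.pieces τ V, x ∉ frontier (tri T.vert) := by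
      rw [Filter.eventually_all_finset]
      intro T _
      exact measure_eq_zero_iff_ae_notMem.1 ((convex_tri T.vert).addHaar_frontier volume)
    filter_upwards [ae_restrict_of_ae hfr, ae_restrict_mem (isClosed_tri V).measurableSet]
      with x hx hxV
    obtain ⟨T, hT, hxT⟩ : ∃ T ∈ c.pieces τ V, x ∈ tri T.vert := by
      simpa using Cut.tri_subset_iUnion_pieces (τ := τ) hc hxV
    have hxi : x ∈ interior (tri T.vert) := by
      by_contra hn
      refine hx T hT ?_
      rw [(isClosed_tri _).frontier_eq]
      exact ⟨hxT, hn⟩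
    have hev : w =ᶠ[nhds x] fun y => α T.side + innerSL ℝ (g T.side) y := by
      filter_upwards [isOpen_interior.mem_nhds hxi] with y hy
      exact H.1 T hT y (interior_subset hy)
    have hder : fderiv ℝ w x = innerSL ℝ (g T.side) := by
      rw [hev.fderiv_eq, fderiv_const_add]
      exact (innerSL ℝ (g T.side)).fderiv
    rw [hder]
    gcongr
    rw [← ofReal_norm, innerSL_apply_norm]
    exact ENNReal.ofReal_le_ofReal (hm _)
  have e : eLpNorm (fderiv ℝ w) 2 (volume.restrict (tri V)) ^ 2 =
      ∫⁻ x in tri V, ‖fderiv ℝ w x‖ₑ ^ 2 := by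
    rw [eLpNorm_eq_lintegral_rpow_enorm_toReal two_ne_zero ENNReal.ofNat_ne_top, ← ENNReal.rpow_natCast,
      ← ENNReal.rpow_mul]
    simp
  rw [e, ← setLIntegral_const]
  exact lintegral_mono_ae hfd

end ComparablyAffine

/-! ### The gradient of the least-squares fit -/

theorem norm_gradient_quad (c : Fin 6 → ℝ) (h : ℝ) (z : Plane) :
    ‖gradient (fun x => quad c (h⁻¹ • (x - z))) z‖ ^ 2 = (h⁻¹) ^ 2 * (c 1 ^ 2 + c 2 ^ 2) := by
  have hp : ∀ i : Fin 2, HasFDerivAt (fun x : Plane => (h⁻¹ • (x - z)) i)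
      (h⁻¹ • (EuclideanSpace.proj i : Plane →L[ℝ] ℝ)) z := by
    intro i
    have := ((EuclideanSpace.proj i : Plane →L[ℝ] ℝ).hasFDerivAt (x := z)).sub_const (z i)
    exact (this.const_mul h⁻¹)
  have hd : HasGradientAt (fun x => quad c (h⁻¹ • (x - z))) (!₂[h⁻¹ * c 1, h⁻¹ * c 2]) z := by
    rw [hasGradientAt_iff_hasFDerivAt]
    have h0 := hp 0
    have h1 := hp 1
    have := (((((h0.const_mul (c 1)).const_add (c 0)).add (h1.const_mul (c 2))).add
      ((h0.pow 2).const_mul (c 3))).add ((h0.mul h1).const_mul (c 4))).add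
      ((h1.pow 2).const_mul (c 5))
    refine (this.congr_fderiv ?_).congr_of_eventuallyEq ?_
    · ext v
      simp [InnerProductSpace.toDual_apply_apply, PiLp.inner_apply, Fin.sum_univ_two]
      ring
    · exact Filter.Eventually.of_forall fun x => rfl
  rw [hd.gradient, EuclideanSpace.norm_sq_eq, Fin.sum_univ_two]
  simp only [Real.norm_eq_abs, sq_abs]
  simp
  ring

/-- The recovered gradient is bounded by the difference quotients over the patch: the fit
reproduces constants, so it suffices to consider `w - w z`. -/
theorem norm_fitGradient_le {κ h B : ℝ} {z : Plane} {K : Finset Plane} {w : Plane → ℝ}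
    (hκ : 0 < κ) (hh : 0 < h) (hK : WellConditioned κ h z K) (hB : 0 ≤ B)
    (hw : ∀ x ∈ K, |w x - w z| ≤ B) :
    ‖fitGradient h z K w‖ ≤ 2 * √(K.card / κ) * (h⁻¹ * B) := by
  have hrhs : 0 ≤ 2 * √(K.card / κ) * (h⁻¹ * B) := by positivity
  refine (pow_le_pow_iff_left₀ (norm_nonneg _) hrhs two_ne_zero).1 ?_
  rw [fitGradient, norm_gradient_quad]
  have e : (2 * √(K.card / κ) * (h⁻¹ * B)) ^ 2 = h⁻¹ ^ 2 * (4 * (K.card * B ^ 2) / κ) := by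
    rw [mul_pow, mul_pow, Real.sq_sqrt (by positivity)]; field_simp; ring
  rw [e]
  refine mul_le_mul_of_nonneg_left ?_ (by positivity)
  unfold fitCoeff
  split_ifs with H
  swap
  · simp; positivity
  set c := H.choose
  have hc := H.choose_spec ![w z, 0, 0, 0, 0, 0]
  have hconst : fitError h z K w ![w z, 0, 0, 0, 0, 0] ≤ K.card * B ^ 2 := by
    unfold fitError
    rw [← nsmul_eq_mul]
    refine Finset.sum_le_card_nsmul _ _ _ fun x hx => ?_
    have : quad ![w z, 0, 0, 0, 0, 0] (h⁻¹ • (x - z)) = w z := by simp [quad]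
    rw [this, ← sq_abs, abs_sub_comm]
    exact pow_le_pow_left₀ (abs_nonneg _) (hw x hx) 2
  have hcK : fitError h z K w c ≤ K.card * B ^ 2 := hc.trans hconst
  -- The coefficients of the fit of `w - w z`.
  have h1 := hK (fun i => c i - ![w z, 0, 0, 0, 0, 0] i)
  have h2 : ∑ x ∈ K, quad (fun i => c i - ![w z, 0, 0, 0, 0, 0] i) (h⁻¹ • (x - z)) ^ 2 ≤
      ∑ x ∈ K, (2 * (quad c (h⁻¹ • (x - z)) - w x) ^ 2 +
        2 * (quad ![w z, 0, 0, 0, 0, 0] (h⁻¹ • (x - z)) - w x) ^ 2) := by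
    refine Finset.sum_le_sum fun x _ => ?_
    have : quad (fun i => c i - ![w z, 0, 0, 0, 0, 0] i) (h⁻¹ • (x - z)) =
        (quad c (h⁻¹ • (x - z)) - w x) - (quad ![w z, 0, 0, 0, 0, 0] (h⁻¹ • (x - z)) - w x) := by
      simp [quad]; ring
    rw [this]
    nlinarith [sq_nonneg ((quad c (h⁻¹ • (x - z)) - w x) +
      (quad ![w z, 0, 0, 0, 0, 0] (h⁻¹ • (x - z)) - w x))]
  rw [Finset.sum_add_distrib, ← Finset.mul_sum, ← Finset.mul_sum] at h2
  change _ ≤ 2 * fitError h z K w c + 2 * fitError h z K w ![w z, 0, 0, 0, 0, 0] at h2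
  rw [le_div_iff₀ hκ]
  have h3 : c 1 ^ 2 + c 2 ^ 2 ≤ ∑ i, (c i - ![w z, 0, 0, 0, 0, 0] i) ^ 2 := by
    rw [Fin.sum_univ_six]
    simp
    nlinarith [sq_nonneg (c 0 - w z), sq_nonneg (c 3), sq_nonneg (c 4), sq_nonneg (c 5)]
  nlinarith

theorem abs_bary_le_one {V : Fin 3 → Plane} {x : Plane} (hx : x ∈ tri V) (k : Fin 3) :
    |bary V k x| ≤ 1 := by
  obtain ⟨w, hw, hw1, rfl⟩ := mem_tri.1 hx
  unfold bary
  by_cases hD : cross (V 1 - V 0) (V 2 - V 0) = 0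
  · simp [hD]
  · have e : cross (V (k + 1) - (w 0 • V 0 + w 1 • V 1 + w 2 • V 2))
        (V (k + 2) - (w 0 • V 0 + w 1 • V 1 + w 2 • V 2)) =
        w k * cross (V 1 - V 0) (V 2 - V 0) := by
      obtain e0 : w 0 = 1 - w 1 - w 2 := by linarith
      fin_cases k <;> simp [cross] <;> rw [e0] <;> ring
    rw [e, mul_div_assoc, div_self hD, mul_one, abs_of_nonneg (hw k)]
    have h0 := hw 0; have h1 := hw 1; have h2 := hw 2
    fin_cases k <;> simp <;> linarith

/-! ### Patches of layers -/

namespace CutMesh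

variable {G : InterfaceDomain} {a b : Plane} {h : ℝ} (M : CutMesh G a b h)

theorem mem_fine {T : FineTri} :
    T ∈ M.fine ↔ T.cell ∈ M.cells ∧ T ∈ (M.cut T.cell).pieces T.cell (M.vert T.cell) := by
  simp only [fine, Finset.mem_biUnion]
  constructor
  · rintro ⟨τ, hτ, hT⟩
    obtain rfl := Cut.cell_of_mem_pieces hT
    exact ⟨hτ, hT⟩
  · rintro ⟨h1, h2⟩; exact ⟨_, h1, h2⟩

variable {M}

theorem proper_of_mem {τ : Cell} (hτ : τ ∈ M.cells) : (M.cut τ).Proper := (M.fits τ hτ).proper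

theorem vert_mem_tri_cell {T : FineTri} (hT : T ∈ M.fine) (k : Fin 3) :
    T.vert k ∈ tri (M.vert T.cell) := by
  obtain ⟨h1, h2⟩ := M.mem_fine.1 hT
  exact Cut.vert_mem_tri_of_mem_pieces (proper_of_mem h1) h2 k

theorem tri_subset_tri_cell {T : FineTri} (hT : T ∈ M.fine) :
    tri T.vert ⊆ tri (M.vert T.cell) := by
  obtain ⟨h1, h2⟩ := M.mem_fine.1 hT
  exact Cut.tri_subset_of_mem_pieces (proper_of_mem h1) h2

theorem mem_layers_succ {σ : Side} {z x : Plane} {n : ℕ} :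
    x ∈ M.layers σ z (n + 1) ↔ x ∈ M.layers σ z n ∨
      ∃ T ∈ M.fine, T.side = σ ∧ (∃ k, T.vert k ∈ M.layers σ z n) ∧ ∃ k, T.vert k = x := by
  simp only [layers, Finset.mem_union, Finset.mem_biUnion, Finset.mem_filter, Finset.mem_image,
    Finset.mem_univ, true_and]
  constructor
  · rintro (h | ⟨T, ⟨h1, h2, h3⟩, h4⟩)
    exacts [Or.inl h, Or.inr ⟨T, h1, h2, h3, h4⟩]
  · rintro (h | ⟨T, h1, h2, h3, h4⟩)
    exacts [Or.inl h, Or.inr ⟨T, ⟨h1, h2, h3⟩, h4⟩]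

theorem mem_layers_zero {σ : Side} {z x : Plane} : x ∈ M.layers σ z 0 ↔ x = z := by
  simp [layers]

open Classical in
/-- The vertices of all pieces of the elements near `τ`. -/
noncomputable def nearVertices (M : CutMesh G a b h) (m : ℕ) (τ : Cell) : Finset Plane :=
  (nearCells m τ).biUnion fun τ' => ((M.cut τ').pieces τ' (M.vert τ')).biUnion fun T =>
    Finset.univ.image T.vert

theorem card_nearVertices_le (m : ℕ) (τ : Cell) :
    (M.nearVertices m τ).card ≤ nearCount m * 9 := by
  classical
  rw [← card_nearCells m τ]
  refine Finset.card_biUnion_le_card_mul _ _ _ fun τ' _ => ?_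
  refine (Finset.card_biUnion_le_card_mul _ _ 3 fun T _ => ?_).trans ?_
  · exact Finset.card_image_le.trans (by simp)
  · have := Cut.card_pieces_le (c := M.cut τ') (τ := τ') (V := M.vert τ')
    omega

/-- A patch of `n` layers stays within the `n` rings of cells around a cell `τ₀` that contains its
centre, and a function whose oscillation on each piece there is at most `B` varies by at most
`n B` over the patch. -/
theorem layers_bound (hc : cross a b ≠ 0) (hh : 0 < h) {σ : Side} {z : Plane} {τ₀ : Cell}
    (hz : z ∈ tri (M.vert τ₀)) {w : Plane → ℝ} {B : ℝ} (hB : 0 ≤ B) {N : ℕ}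
    (hw : ∀ T ∈ M.fine, T.cell ∈ nearCells N τ₀ → ∀ k l, |w (T.vert k) - w (T.vert l)| ≤ B) :
    ∀ n ≤ N, ∀ x ∈ M.layers σ z n, |w x - w z| ≤ n * B ∧
      (∃ τ ∈ nearCells n τ₀, x ∈ tri (M.vert τ)) ∧ (x = z ∨ x ∈ M.nearVertices N τ₀) := by
  classical
  intro n
  induction n with
  | zero =>
    intro _ x hx
    rw [mem_layers_zero] at hx
    subst hx
    exact ⟨by simp, ⟨τ₀, self_mem_nearCells _ _, hz⟩, Or.inl rfl⟩
  | succ n ih =>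
    intro hn x hx
    have step : ∀ T ∈ M.fine, (∃ k, T.vert k ∈ M.layers σ z n) →
        T.cell ∈ nearCells (n + 1) τ₀ := by
      rintro T hT ⟨k, hk⟩
      obtain ⟨-, ⟨τ, hτ, hxτ⟩, -⟩ := ih (by omega) _ hk
      exact nearCells_trans hτ (mem_nearCells_of_common_point hc hh hxτ (vert_mem_tri_cell hT k))
    rw [mem_layers_succ] at hx
    rcases hx with hx | ⟨T, hT, -, hk, l, rfl⟩
    · obtain ⟨h1, ⟨τ, hτ, hxτ⟩, h3⟩ := ih (by omega) _ hx
      refine ⟨h1.trans ?_, ⟨τ, nearCells_mono (by omega) _ hτ, hxτ⟩, h3⟩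
      push_cast; linarith
    · have hTc := step T hT hk
      obtain ⟨k, hk⟩ := hk
      obtain ⟨h1, -, -⟩ := ih (by omega) _ hk
      have h2 := hw T hT (nearCells_mono hn _ hTc) l k
      refine ⟨?_, ⟨T.cell, hTc, vert_mem_tri_cell hT l⟩, Or.inr ?_⟩
      · have := abs_add_le (w (T.vert l) - w (T.vert k)) (w (T.vert k) - w z)
        rw [sub_add_sub_cancel] at this
        push_cast; linarith
      · simp only [nearVertices, Finset.mem_biUnion, Finset.mem_image, Finset.mem_univ, true_and]
        exact ⟨T.cell, nearCells_mono hn _ hTc, T, (M.mem_fine.1 hT).2, l, rfl⟩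

theorem card_layers_le (hc : cross a b ≠ 0) (hh : 0 < h) {σ : Side} {z : Plane} {τ₀ : Cell}
    (hz : z ∈ tri (M.vert τ₀)) {n N : ℕ} (hn : n ≤ N) :
    (M.layers σ z n).card ≤ nearCount N * 9 + 1 := by
  classical
  have hsub : M.layers σ z n ⊆ insert z (M.nearVertices N τ₀) := by
    intro x hx
    have := (layers_bound (σ := σ) hc hh hz (w := 0) le_rfl (N := N) (by simp) n hn x hx).2.2
    rwa [Finset.mem_insert]
  exact (Finset.card_le_card hsub).trans ((Finset.card_insert_le _ _).trans
    (Nat.succ_le_succ (card_nearVertices_le N τ₀)))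

end CutMesh

namespace CutMesh

variable {G : InterfaceDomain} {a b : Plane} {h : ℝ} {M : CutMesh G a b h}

/-! ### The enriching operator -/

/-- The oscillation of `v τ` over the vertices of the pieces of an element `τ` is at most
`D h (m τ)`, and the values at common vertices of elements of the uniform mesh agree. -/
structure NodalBound (M : CutMesh G a b h) (v : Cell → Plane → ℝ) (D : ℝ) (m : Cell → ℝ) :
    Prop where
  nonneg : ∀ τ, 0 ≤ m τ
  osc : ∀ τ ∈ M.cells, ∀ p q, (M.cut τ).IsVertex τ (M.vert τ) p →
    (M.cut τ).IsVertex τ (M.vert τ) q → |v τ p - v τ q| ≤ D * h * m τ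
  conforming : ∀ τ ∈ M.cells, ∀ τ' ∈ M.cells, ∀ i j : Fin 3,
    M.vert τ i = M.vert τ' j → v τ (M.vert τ i) = v τ' (M.vert τ' j)

open Classical in
/-- The sum of `m` over the elements of the mesh near `τ`. -/
noncomputable def nearSum (M : CutMesh G a b h) (m : Cell → ℝ) (n : ℕ) (τ : Cell) : ℝ :=
  ∑ τ' ∈ M.cells.filter (· ∈ nearCells n τ), m τ'

theorem le_nearSum {m : Cell → ℝ} (hm : ∀ τ, 0 ≤ m τ) {n : ℕ} {τ τ' : Cell} (hτ' : τ' ∈ M.cells)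
    (hn : τ' ∈ nearCells n τ) : m τ' ≤ M.nearSum m n τ := by
  classical
  exact Finset.single_le_sum (f := m) (fun i _ => hm i) (Finset.mem_filter.2 ⟨hτ', hn⟩)

theorem nearSum_nonneg {m : Cell → ℝ} (hm : ∀ τ, 0 ≤ m τ) (n : ℕ) (τ : Cell) :
    0 ≤ M.nearSum m n τ := Finset.sum_nonneg fun i _ => hm i

/-- The enriched function stays close to `v` at the vertices of the body-fitted mesh. -/
theorem NodalBound.abs_enrich_sub_le {v : Cell → Plane → ℝ} {D : ℝ} {m : Cell → ℝ}
    (H : M.NodalBound v D m) (hD : 0 ≤ D) (hc : cross a b ≠ 0) (hh : 0 < h) {N : ℕ} {τ₀ : Cell}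
    {T : FineTri} (hT : T ∈ M.fine) (hTn : T.cell ∈ nearCells N τ₀) (k : Fin 3) :
    |M.enrich v (T.vert k) - v T.cell (T.vert k)| ≤ 2 * (D * h * M.nearSum m (N + 1) τ₀) := by
  classical
  set S := M.nearSum m (N + 1) τ₀
  obtain ⟨hTc, hTp⟩ := M.mem_fine.1 hT
  have hDh : 0 ≤ D * h := by positivity
  set F := M.fine.filter fun T' => ∃ l, T'.vert l = T.vert k with hF
  have hcard : (0 : ℝ) < F.card := by
    have : T ∈ F := Finset.mem_filter.2 ⟨hT, k, rfl⟩
    exact_mod_cast Finset.card_pos.2 ⟨T, this⟩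
  have hjump : ∀ T' ∈ F, |v T'.cell (T.vert k) - v T.cell (T.vert k)| ≤ 2 * (D * h * S) := by
    intro T' hT'
    obtain ⟨hT'f, l, hl⟩ := Finset.mem_filter.1 hT'
    obtain ⟨hT'c, hT'p⟩ := M.mem_fine.1 hT'f
    have hp' : T.vert k ∈ tri (M.vert T'.cell) := hl ▸ vert_mem_tri_cell hT'f l
    have hp : T.vert k ∈ tri (M.vert T.cell) := vert_mem_tri_cell hT k
    -- The two elements share a vertex of the uniform mesh, where both functions agree.
    obtain ⟨i, j, hij⟩ := exists_common_vertex hc hh.ne' hp' hp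
    have e := H.conforming _ hT'c _ hTc i j hij
    have h1 := H.osc _ hT'c (T.vert k) (M.vert T'.cell i) ⟨T', hT'p, l, hl⟩
      (Cut.isVertex_vert _ _ _ i)
    have h2 := H.osc _ hTc (M.vert T.cell j) (T.vert k) (Cut.isVertex_vert _ _ _ j)
      ⟨T, hTp, k, rfl⟩
    have n1 : m T'.cell ≤ S := le_nearSum H.nonneg hT'c
      (nearCells_trans hTn (mem_nearCells_of_common_point hc hh hp hp'))
    have n2 : m T.cell ≤ S := le_nearSum H.nonneg hTc (nearCells_mono (by omega) _ hTn)
    have g1 := mul_le_mul_of_nonneg_left n1 hDh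
    have g2 := mul_le_mul_of_nonneg_left n2 hDh
    have := abs_add_le (v T'.cell (T.vert k) - v T'.cell (M.vert T'.cell i))
      (v T.cell (M.vert T.cell j) - v T.cell (T.vert k))
    rw [e, sub_add_sub_cancel] at this
    rw [e] at h1
    linarith
  have e : M.enrich v (T.vert k) - v T.cell (T.vert k) =
      (F.card : ℝ)⁻¹ * ∑ T' ∈ F, (v T'.cell (T.vert k) - v T.cell (T.vert k)) := by
    rw [Finset.sum_sub_distrib, Finset.sum_const, nsmul_eq_mul, mul_sub, ← mul_assoc,
      inv_mul_cancel₀ hcard.ne', one_mul]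
    simp only [enrich, hF]
  rw [e, abs_mul, abs_inv, abs_of_pos hcard, inv_mul_le_iff₀ hcard]
  refine (Finset.abs_sum_le_sum_abs _ _).trans ?_
  refine (Finset.sum_le_card_nsmul _ _ _ hjump).trans ?_
  rw [nsmul_eq_mul]

/-- The recovered gradient at the vertices in an element is bounded by the gradients on the
elements nearby. -/
theorem NodalBound.norm_fitGradient_le {v : Cell → Plane → ℝ} {D : ℝ} {m : Cell → ℝ}
    (H : M.NodalBound v D m) (hD : 0 ≤ D) (hc : cross a b ≠ 0) (hh : 0 < h) {κ : ℝ} (hκ : 0 < κ)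
    {N n : ℕ} (hn : n ≤ N) {σ : Side} {z : Plane} {τ₀ : Cell} (hz : z ∈ tri (M.vert τ₀))
    (hK : WellConditioned κ h z (M.layers σ z n)) :
    ‖fitGradient h z (M.layers σ z n) (M.enrich v)‖ ≤
      2 * √((nearCount N * 9 + 1 : ℕ) / κ) * (N * (5 * D)) * M.nearSum m (N + 1) τ₀ := by
  set S := M.nearSum m (N + 1) τ₀
  have hS : 0 ≤ S := nearSum_nonneg H.nonneg _ _
  -- On one triangle: twice the distance of `E_h v` to `v`, and the oscillation of `v`.
  have hw : ∀ T ∈ M.fine, T.cell ∈ nearCells N τ₀ → ∀ k l,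
      |M.enrich v (T.vert k) - M.enrich v (T.vert l)| ≤ 5 * D * h * S := by
    intro T hT hTn k l
    obtain ⟨hTc, hTp⟩ := M.mem_fine.1 hT
    have h1 := H.abs_enrich_sub_le hD hc hh hT hTn k
    have h2 := H.abs_enrich_sub_le hD hc hh hT hTn l
    have h3 := H.osc _ hTc (T.vert k) (T.vert l) ⟨T, hTp, k, rfl⟩ ⟨T, hTp, l, rfl⟩
    have h4 : D * h * m T.cell ≤ D * h * S :=
      mul_le_mul_of_nonneg_left (le_nearSum H.nonneg hTc (nearCells_mono (by omega) _ hTn))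
        (by positivity)
    rw [abs_le] at *
    constructor <;> linarith [h1.1, h1.2, h2.1, h2.2, h3.1, h3.2]
  have hB : 0 ≤ 5 * D * h * S := by positivity
  have hfit := IFEM.norm_fitGradient_le (B := N * (5 * D * h * S)) hκ hh hK (by positivity)
    (fun x hx => ((layers_bound hc hh hz hB hw n hn x hx).1.trans
      (mul_le_mul_of_nonneg_right (by exact_mod_cast hn) hB)) : ∀ x ∈ M.layers σ z n,
        |M.enrich v x - M.enrich v z| ≤ N * (5 * D * h * S))
  refine hfit.trans ?_
  have e : h⁻¹ * (N * (5 * D * h * S)) = N * (5 * D) * S := by field_simp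
  rw [e, mul_assoc (2 * √((nearCount N * 9 + 1 : ℕ) / κ))]
  have hcard : ((M.layers σ z n).card : ℝ) ≤ (nearCount N * 9 + 1 : ℕ) := by
    exact_mod_cast card_layers_le hc hh hz hn
  gcongr

/-! ### Stability of the recovery -/

open Classical in
/-- The factor `9` counts the vertices of the at most three pieces of an element. -/
theorem norm_ippr_le {n : Side → Plane → ℕ} {w : Plane → ℝ} {B : Cell → ℝ}
    (hB : ∀ τ, 0 ≤ B τ)
    (hw : ∀ T ∈ M.fine, ∀ k, ‖fitGradient h (T.vert k)
      (M.layers T.side (T.vert k) (n T.side (T.vert k))) w‖ ≤ B T.cell) (x : Plane) :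
    ‖M.ippr n w x‖ ≤ ∑ τ ∈ M.cells.filter (fun τ => x ∈ tri (M.vert τ)), 9 * B τ := by
  unfold ippr
  have h1 : ∀ T ∈ M.fine, ‖(interior (tri T.vert)).indicator
      (fun y => ∑ k, bary T.vert k y •
        fitGradient h (T.vert k) (M.layers T.side (T.vert k) (n T.side (T.vert k))) w) x‖ ≤
      if x ∈ tri (M.vert T.cell) then 3 * B T.cell else 0 := by
    intro T hT
    by_cases hx : x ∈ interior (tri T.vert)
    · have hxT := interior_subset hx
      rw [Set.indicator_of_mem hx, if_pos (tri_subset_tri_cell hT hxT)]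
      refine (norm_sum_le _ _).trans ?_
      refine (Finset.sum_le_card_nsmul _ _ (B T.cell) fun k _ => ?_).trans (by simp)
      rw [norm_smul, Real.norm_eq_abs]
      exact (mul_le_mul (abs_bary_le_one hxT k) (hw T hT k) (norm_nonneg _) zero_le_one).trans
        (by rw [one_mul])
    · rw [Set.indicator_of_notMem hx, norm_zero]
      have := hB T.cell
      split_ifs <;> linarith
  refine (norm_sum_le _ _).trans ((Finset.sum_le_sum h1).trans ?_)
  rw [← Finset.sum_fiberwise_of_maps_to (g := FineTri.cell) (t := M.cells)
    (fun T hT => (M.mem_fine.1 hT).1), Finset.sum_filter]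
  refine Finset.sum_le_sum fun τ _ => ?_
  have h2 : ∀ T ∈ M.fine.filter (FineTri.cell · = τ),
      (if x ∈ tri (M.vert T.cell) then 3 * B T.cell else 0) =
        if x ∈ tri (M.vert τ) then 3 * B τ else 0 := by
    intro T hT; rw [(Finset.mem_filter.1 hT).2]
  rw [Finset.sum_congr rfl h2, Finset.sum_const, nsmul_eq_mul]
  have h3 : ((M.fine.filter (FineTri.cell · = τ)).card : ℝ) ≤ 3 := by
    have : (M.fine.filter (FineTri.cell · = τ)).card ≤
        ((M.cut τ).pieces τ (M.vert τ)).card := by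
      refine Finset.card_le_card fun T hT => ?_
      obtain ⟨h4, rfl⟩ := Finset.mem_filter.1 hT
      exact (M.mem_fine.1 h4).2
    exact_mod_cast this.trans Cut.card_pieces_le
  have := hB τ
  split_ifs
  · nlinarith
  · simp

/-- The squared `L²` norm of the recovered gradient is bounded elementwise: at most
`nearCount 1` elements contain a given point. -/
theorem eLpNorm_ippr_sq_le (hc : cross a b ≠ 0) (hh : 0 < h) {n : Side → Plane → ℕ}
    {w : Plane → ℝ} {B : Cell → ℝ} (hB : ∀ τ, 0 ≤ B τ)
    (hw : ∀ T ∈ M.fine, ∀ k, ‖fitGradient h (T.vert k)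
      (M.layers T.side (T.vert k) (n T.side (T.vert k))) w‖ ≤ B T.cell) :
    eLpNorm (M.ippr n w) 2 volume ^ 2 ≤
      ∑ τ ∈ M.cells, ENNReal.ofReal (81 * nearCount 1 * B τ ^ 2) * volume (tri (M.vert τ)) := by
  classical
  have e : eLpNorm (M.ippr n w) 2 volume ^ 2 = ∫⁻ x, ‖M.ippr n w x‖ₑ ^ 2 := by
    rw [eLpNorm_eq_lintegral_rpow_enorm_toReal two_ne_zero ENNReal.ofNat_ne_top,
      ← ENNReal.rpow_natCast, ← ENNReal.rpow_mul]
    simp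
  have hpt : ∀ x, ‖M.ippr n w x‖ₑ ^ 2 ≤ ∑ τ ∈ M.cells,
      (tri (M.vert τ)).indicator (fun _ => ENNReal.ofReal (81 * nearCount 1 * B τ ^ 2)) x := by
    intro x
    set A := M.cells.filter (fun τ => x ∈ tri (M.vert τ)) with hA
    have hle := norm_ippr_le hB hw x
    have hcard : (A.card : ℝ) ≤ nearCount 1 := by
      rcases A.eq_empty_or_nonempty with h0 | ⟨τ₀, hτ₀⟩
      · rw [h0]; simp
      · have hsub : A ⊆ nearCells 1 τ₀ := fun τ hτ => mem_nearCells_of_common_point hc hh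
          (Finset.mem_filter.1 hτ₀).2 (Finset.mem_filter.1 hτ).2
        exact_mod_cast (Finset.card_le_card hsub).trans (card_nearCells 1 τ₀).le
    have hsq : ‖M.ippr n w x‖ ^ 2 ≤ ∑ τ ∈ A, 81 * nearCount 1 * B τ ^ 2 := by
      calc ‖M.ippr n w x‖ ^ 2 ≤ (∑ τ ∈ A, 9 * B τ) ^ 2 :=
            pow_le_pow_left₀ (norm_nonneg _) hle 2
        _ ≤ A.card * ∑ τ ∈ A, (9 * B τ) ^ 2 := sq_sum_le_card_mul_sum_sq
        _ ≤ nearCount 1 * ∑ τ ∈ A, (9 * B τ) ^ 2 :=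
            mul_le_mul_of_nonneg_right hcard (Finset.sum_nonneg fun _ _ => sq_nonneg _)
        _ = _ := by rw [Finset.mul_sum]; refine Finset.sum_congr rfl fun τ _ => ?_; ring
    have e1 : ‖M.ippr n w x‖ₑ ^ 2 = ENNReal.ofReal (‖M.ippr n w x‖ ^ 2) := by
      rw [ENNReal.ofReal_pow (norm_nonneg _), ofReal_norm]
    rw [e1]
    refine (ENNReal.ofReal_le_ofReal hsq).trans ?_
    rw [ENNReal.ofReal_sum_of_nonneg (fun τ _ => by positivity), hA, Finset.sum_filter]
    refine le_of_eq (Finset.sum_congr rfl fun τ _ => ?_)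
    rw [Set.indicator_apply]
  rw [e]
  refine (lintegral_mono hpt).trans ?_
  rw [lintegral_finsetSum _ fun τ _ =>
    measurable_const.indicator (isClosed_tri (M.vert τ)).measurableSet]
  refine le_of_eq (Finset.sum_congr rfl fun τ _ => ?_)
  rw [lintegral_indicator (isClosed_tri (M.vert τ)).measurableSet, setLIntegral_const]

theorem sum_nearSum_sq_le (m : Cell → ℝ) (n : ℕ) :
    ∑ τ ∈ M.cells, M.nearSum m n τ ^ 2 ≤ (nearCount n : ℝ) ^ 2 * ∑ τ ∈ M.cells, m τ ^ 2 := by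
  classical
  have hcard : ∀ τ, ((M.cells.filter (· ∈ nearCells n τ)).card : ℝ) ≤ nearCount n := by
    intro τ
    rw [← card_nearCells n τ]
    exact_mod_cast Finset.card_le_card fun τ' h => (Finset.mem_filter.1 h).2
  calc ∑ τ ∈ M.cells, M.nearSum m n τ ^ 2
      ≤ ∑ τ ∈ M.cells, nearCount n * ∑ τ' ∈ M.cells.filter (· ∈ nearCells n τ), m τ' ^ 2 := by
        refine Finset.sum_le_sum fun τ _ => ?_
        refine sq_sum_le_card_mul_sum_sq.trans ?_
        exact mul_le_mul_of_nonneg_right (hcard τ) (Finset.sum_nonneg fun _ _ => sq_nonneg _)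
    _ = nearCount n * ∑ τ' ∈ M.cells, (M.cells.filter (· ∈ nearCells n τ')).card * m τ' ^ 2 := by
        rw [← Finset.mul_sum]
        congr 1
        simp only [Finset.sum_filter]
        rw [Finset.sum_comm]
        refine Finset.sum_congr rfl fun τ' _ => ?_
        rw [← Finset.sum_filter, Finset.sum_const, nsmul_eq_mul]
        congr 3
        ext τ
        simp only [Finset.mem_filter]
        rw [mem_nearCells_comm]
    _ ≤ nearCount n * ∑ τ' ∈ M.cells, nearCount n * m τ' ^ 2 := by
        refine mul_le_mul_of_nonneg_left (Finset.sum_le_sum fun τ' _ => ?_) (by positivity)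
        exact mul_le_mul_of_nonneg_right (hcard τ') (sq_nonneg _)
    _ = _ := by rw [← Finset.mul_sum]; ring

/-- Every function of the immersed finite element space satisfies a nodal bound whose weights are
controlled by the Dirichlet energies of the elements. -/
theorem exists_nodalBound (hh : 0 < h) {β : Side → Plane → ℝ} {β₀ β₁ : ℝ}
    (hβ₀ : 0 < β₀) (hβ : ∀ σ, ∀ x ∈ closure (G.sub σ), β₀ ≤ β σ x ∧ β σ x ≤ β₁)
    {ξ : Cell → Side → Plane} (hξ : M.IsSampling ξ) {v : Cell → Plane → ℝ}
    (hv : M.IFESpace β ξ v) :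
    ∃ m : Cell → ℝ, M.NodalBound v (4 * (‖a‖ + ‖b‖)) m ∧ ∀ τ ∈ M.cells,
      ENNReal.ofReal (m τ ^ 2) * volume (tri (M.vert τ)) ≤
        ENNReal.ofReal (max 1 (β₁ / β₀) ^ 4) *
          eLpNorm (fderiv ℝ (v τ)) 2 (volume.restrict (tri (M.vert τ))) ^ 2 := by
  classical
  set ρ := max 1 (β₁ / β₀)
  have hρ : 0 < ρ := lt_of_lt_of_le one_pos (le_max_left _ _)
  have hloc : ∀ τ, ∃ αg : (Side → ℝ) × (Side → Plane), τ ∈ M.cells →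
      ComparablyAffine (M.cut τ) τ (M.vert τ) ρ (v τ) αg.1 αg.2 := by
    intro τ
    by_cases hτ : τ ∈ M.cells
    · have hs := hξ τ hτ
      obtain ⟨α, g, H⟩ := (hv.1 τ hτ).comparablyAffine hβ₀
        (fun hI => hβ _ _ (hs hI .minus).2) (fun hI => hβ _ _ (hs hI .plus).2)
      exact ⟨(α, g), fun _ => H⟩
    · exact ⟨(0, 0), fun h => absurd h hτ⟩
  choose αg H using hloc
  refine ⟨fun τ => ρ * ‖(αg τ).2 .plus‖, ⟨fun τ => by positivity, ?_, hv.2⟩, ?_⟩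
  · intro τ hτ p q hp hq
    have := (H τ hτ).abs_sub_le (proper_of_mem hτ) (m := ρ * ‖(αg τ).2 .plus‖)
      (D := 2 * (‖a‖ + ‖b‖) * h) (by positivity)
      (fun x hx y hy => dist_le_of_mem_tri_cell hh hx hy) (fun σ => (H τ hτ).2 σ .plus) hp hq
    linarith
  · intro τ hτ
    have h1 := (H τ hτ).sq_mul_volume_le (proper_of_mem hτ) (m := ρ⁻¹ * ‖(αg τ).2 .plus‖)
      (fun σ => by rw [inv_mul_le_iff₀ hρ]; exact (H τ hτ).2 .plus σ)
    calc ENNReal.ofReal ((ρ * ‖(αg τ).2 .plus‖) ^ 2) * volume (tri (M.vert τ))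
        = ENNReal.ofReal (ρ ^ 4) * (ENNReal.ofReal (ρ⁻¹ * ‖(αg τ).2 .plus‖) ^ 2 *
            volume (tri (M.vert τ))) := by
          rw [← mul_assoc, ← ENNReal.ofReal_pow (by positivity),
            ← ENNReal.ofReal_mul (by positivity)]
          congr 2
          field_simp
      _ ≤ _ := mul_le_mul_right h1 _

/-- Stability of the gradient recovery operator, uniformly in all meshes. -/
theorem exists_stability (hc : cross a b ≠ 0) {β : Side → Plane → ℝ} {β₀ β₁ : ℝ}
    (hβ₀ : 0 < β₀) (hβ : ∀ σ, ∀ x ∈ closure (G.sub σ), β₀ ≤ β σ x ∧ β σ x ≤ β₁)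
    {κ : ℝ} (hκ : 0 < κ) (N : ℕ) :
    ∃ C : ℝ≥0, ∀ h : ℝ, 0 < h → ∀ M : CutMesh G a b h,
      ∀ n : Side → Plane → ℕ, M.IsPatchChoice κ N n →
      ∀ ξ : Cell → Side → Plane, M.IsSampling ξ →
      ∀ v : Cell → Plane → ℝ, M.IFESpace β ξ v →
        eLpNorm (M.recover n v) 2 (volume.restrict (G.sub .minus ∪ G.sub .plus)) ≤
          C * M.brokenSeminorm v := by
  classical
  set D := 4 * (‖a‖ + ‖b‖)
  have hD : 0 ≤ D := by positivity
  set ρ := max 1 (β₁ / β₀)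
  set C₁ : ℝ := 2 * √((nearCount N * 9 + 1 : ℕ) / κ) * (N * (5 * D)) with hC₁
  have hC₁0 : 0 ≤ C₁ := by positivity
  -- The constant of the real inequality between the nodal weights.
  obtain ⟨C₃, hC₃⟩ : ∃ C₃ : ℝ, C₃ = 81 * nearCount 1 * C₁ ^ 2 * nearCount (N + 1) ^ 2 := ⟨_, rfl⟩
  have hC₃0 : 0 ≤ C₃ := by rw [hC₃]; positivity
  set C₂ : ℝ := C₃ * ρ ^ 4 with hC₂
  have hC₂0 : 0 ≤ C₂ := by positivity
  refine ⟨(√C₂).toNNReal, fun h hh M n hn ξ hξ v hv => ?_⟩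
  obtain ⟨m, hm, hmv⟩ := M.exists_nodalBound hh hβ₀ hβ hξ hv
  have hB : ∀ τ, 0 ≤ C₁ * M.nearSum m (N + 1) τ := fun τ =>
    mul_nonneg hC₁0 (nearSum_nonneg hm.nonneg _ _)
  have hw : ∀ T ∈ M.fine, ∀ k, ‖fitGradient h (T.vert k)
      (M.layers T.side (T.vert k) (n T.side (T.vert k))) (M.enrich v)‖ ≤
        C₁ * M.nearSum m (N + 1) T.cell := by
    intro T hT k
    have hz : T.vert k ∈ M.nodes T.side := by
      simp only [nodes, Finset.mem_biUnion, Finset.mem_filter, Finset.mem_image, Finset.mem_univ,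
        true_and]
      exact ⟨T, ⟨hT, rfl⟩, k, rfl⟩
    obtain ⟨h1, h2⟩ := hn T.side _ hz
    exact hm.norm_fitGradient_le hD hc hh hκ h1 (vert_mem_tri_cell hT k) h2
  have hsq : eLpNorm (M.recover n v) 2 (volume.restrict (G.sub .minus ∪ G.sub .plus)) ^ 2 ≤
      ENNReal.ofReal C₂ * ∑ τ ∈ M.cells,
        eLpNorm (fderiv ℝ (v τ)) 2 (volume.restrict (tri (M.vert τ))) ^ 2 := by
    have h1 : eLpNorm (M.recover n v) 2 (volume.restrict (G.sub .minus ∪ G.sub .plus)) ≤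
        eLpNorm (M.ippr n (M.enrich v)) 2 volume := eLpNorm_mono_measure _ Measure.restrict_le_self
    refine (pow_le_pow_left₀ zero_le h1 2).trans ((eLpNorm_ippr_sq_le hc hh hB hw).trans ?_)
    rcases M.cells.eq_empty_or_nonempty with h0 | ⟨τ₀, -⟩
    · simp [h0]
    have hvol : ∀ τ, volume (tri (M.vert τ)) = volume (tri (M.vert τ₀)) := fun τ =>
      volume_tri_cell hc hh.ne' τ τ₀
    set V := volume (tri (M.vert τ₀))
    simp only [hvol] at hmv ⊢
    rw [← Finset.sum_mul, ← ENNReal.ofReal_sum_of_nonneg (fun τ _ => by positivity)]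
    have hreal : ∑ τ ∈ M.cells, 81 * nearCount 1 * (C₁ * M.nearSum m (N + 1) τ) ^ 2 ≤
        C₃ * ∑ τ ∈ M.cells, m τ ^ 2 := by
      have := mul_le_mul_of_nonneg_left (M.sum_nearSum_sq_le m (N + 1))
        (by positivity : 0 ≤ 81 * (nearCount 1 : ℝ) * C₁ ^ 2)
      rw [Finset.mul_sum, ← mul_assoc, ← hC₃] at this
      refine le_trans (le_of_eq (Finset.sum_congr rfl fun τ _ => ?_)) this
      ring
    refine (mul_le_mul_left (ENNReal.ofReal_le_ofReal hreal) V).trans ?_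
    rw [ENNReal.ofReal_mul (by positivity), ENNReal.ofReal_sum_of_nonneg (fun τ _ => sq_nonneg _),
      mul_assoc, Finset.sum_mul, hC₂, ENNReal.ofReal_mul hC₃0, mul_assoc]
    refine mul_le_mul_right ?_ _
    rw [Finset.mul_sum]
    exact Finset.sum_le_sum hmv
  -- Take square roots.
  have hroot := ENNReal.rpow_le_rpow hsq (by norm_num : (0 : ℝ) ≤ 1 / 2)
  rw [ENNReal.mul_rpow_of_nonneg _ _ (by norm_num), ← ENNReal.rpow_natCast, ← ENNReal.rpow_mul,
    ENNReal.ofReal_rpow_of_nonneg hC₂0 (by norm_num), ← Real.sqrt_eq_rpow] at hroot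
  norm_num at hroot
  exact hroot

end CutMesh

/-! ### How the interface meets the edges of an element -/

theorem Side.eq_or_eq_other (σ ς : Side) : σ = ς ∨ σ = ς.other := by
  cases σ <;> cases ς <;> simp [Side.other]

theorem Side.other_other (σ : Side) : σ.other.other = σ := by cases σ <;> rfl

namespace InterfaceDomain

variable {G : InterfaceDomain}

theorem disjoint_of_ne {σ σ' : Side} (h : σ ≠ σ') : Disjoint (G.sub σ) (G.sub σ') := by
  cases σ <;> cases σ' <;> first | exact absurd rfl h | exact G.sub_disjoint |
    exact G.sub_disjoint.symm

theorem eq_of_mem_closure {σ σ' : Side} {x : Plane} (hx : x ∈ G.sub σ)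
    (hx' : x ∈ closure (G.sub σ')) : σ = σ' := by
  by_contra hne
  obtain ⟨y, h1, h2⟩ := mem_closure_iff.1 hx' _ (G.sub_open σ) hx
  exact Set.disjoint_left.1 (disjoint_of_ne hne) h1 h2

theorem notMem_closure_Γ {σ : Side} {x : Plane} (hx : x ∈ G.sub σ) : x ∉ closure G.Γ := by
  intro hx'
  obtain ⟨y, h1, h2⟩ := mem_closure_iff.1 hx' _ (G.sub_open σ) hx
  refine h2.2 ?_
  cases σ
  exacts [Or.inl h1, Or.inr h1]

theorem mem_sub_of_mem_closure {σ : Side} {x : Plane} (hx : x ∈ G.Ω) (hΓ : x ∉ closure G.Γ)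
    (hσ : x ∈ closure (G.sub σ)) : x ∈ G.sub σ := by
  have h1 : x ∈ G.sub .minus ∪ G.sub .plus := by
    by_contra hn
    exact hΓ (subset_closure ⟨hx, hn⟩)
  rcases h1 with h1 | h1 <;> rwa [← eq_of_mem_closure h1 hσ]

end InterfaceDomain

theorem lineMap_mem_segment_left {E : Type*} [AddCommGroup E] [Module ℝ E] {A B : E} {s θ : ℝ}
    (h0 : 0 ≤ θ) (h1 : θ ≤ s) :
    AffineMap.lineMap A B θ ∈ segment ℝ A (AffineMap.lineMap A B s) := by
  rw [segment_eq_image_lineMap]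
  rcases eq_or_lt_of_le (h0.trans h1) with hs | hs
  · obtain rfl : θ = s := by linarith
    exact ⟨1, by simp, by simp⟩
  · refine ⟨θ / s, ⟨by positivity, (div_le_one hs).2 h1⟩, ?_⟩
    rw [AffineMap.lineMap_lineMap_right, div_mul_cancel₀ _ hs.ne']

theorem lineMap_mem_segment_right {E : Type*} [AddCommGroup E] [Module ℝ E] {A B : E} {s θ : ℝ}
    (h0 : s ≤ θ) (h1 : θ ≤ 1) :
    AffineMap.lineMap A B θ ∈ segment ℝ (AffineMap.lineMap A B s) B := by
  rw [segment_symm, ← AffineMap.lineMap_apply_one_sub B A s, ← AffineMap.lineMap_apply_one_sub B A θ]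
  exact lineMap_mem_segment_left (by linarith) (by linarith)

/-- A triangle with vertices not on a line. -/
def Nondegenerate (V : Fin 3 → Plane) : Prop :=
  ∀ k, cross (V (k + 1) - V k) (V (k + 2) - V k) ≠ 0

theorem Nondegenerate.eq_zero {V : Fin 3 → Plane} (hV : Nondegenerate V) {k : Fin 3} {x y : ℝ}
    (h : x • (V (k + 1) - V k) + y • (V (k + 2) - V k) = 0) : x = 0 ∧ y = 0 := by
  have h0 := congrArg (fun u : Plane => u 0) h
  have h1 := congrArg (fun u : Plane => u 1) h
  simp only [PiLp.add_apply, PiLp.smul_apply, smul_eq_mul, PiLp.zero_apply] at h0 h1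
  have hk := hV k
  unfold cross at hk
  constructor
  · refine (mul_eq_zero.1 ?_).resolve_right hk
    linear_combination (V (k + 2) - V k) 1 * h0 - (V (k + 2) - V k) 0 * h1
  · refine (mul_eq_zero.1 ?_).resolve_right hk
    linear_combination (V (k + 1) - V k) 0 * h1 - (V (k + 1) - V k) 1 * h0

theorem Nondegenerate.injective {V : Fin 3 → Plane} (hV : Nondegenerate V) :
    Function.Injective V := by
  have key : ∀ k, V k ≠ V (k + 1) ∧ V k ≠ V (k + 2) := by
    intro k
    have hk := hV k
    constructor <;> intro e <;> rw [← e] at hk <;> simp [cross] at hk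
  intro i j hij
  fin_cases i <;> fin_cases j <;> first | rfl | exact absurd hij (key _).1 |
    exact absurd hij (key _).2

/-- The edges of a triangle lie in its frontier. -/
theorem Nondegenerate.lineMap_mem_frontier {V : Fin 3 → Plane} (hV : Nondegenerate V) {i j : Fin 3}
    (hij : i ≠ j) {θ : ℝ} (h0 : 0 ≤ θ) (h1 : θ ≤ 1) :
    AffineMap.lineMap (V i) (V j) θ ∈ frontier (tri V) := by
  have key : ∀ (k : Fin 3) (θ : ℝ), 0 ≤ θ → θ ≤ 1 →
      AffineMap.lineMap (V (k + 1)) (V (k + 2)) θ ∈ frontier (tri V) := by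
    intro k θ h0 h1
    set x : Plane := AffineMap.lineMap (V (k + 1)) (V (k + 2)) θ with hx
    have hxe : x = (1 - θ) • V (k + 1) + θ • V (k + 2) := AffineMap.lineMap_apply_module _ _ _
    have hxt : x ∈ tri V := segment_subset_tri V _ _ (by
      rw [segment_eq_image_lineMap]; exact ⟨θ, ⟨h0, h1⟩, rfl⟩)
    rw [(isClosed_tri V).frontier_eq]
    refine ⟨hxt, fun hxi => ?_⟩
    -- Moving from an interior point away from `V k` would stay in the triangle.
    have hlim : Filter.Tendsto (fun ε : ℝ => x + ε • (x - V k)) (nhds 0) (nhds x) := by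
      have : Continuous fun ε : ℝ => x + ε • (x - V k) := by fun_prop
      simpa using this.tendsto 0
    obtain ⟨δ, hδ, hball⟩ := Metric.eventually_nhds_iff.1
      (hlim.eventually (mem_interior_iff_mem_nhds.1 hxi))
    have hmem : x + (δ / 2) • (x - V k) ∈ tri V := hball (by
      rw [Real.dist_eq, sub_zero, abs_of_pos (by positivity)]; linarith)
    rw [tri_eq_rotate V k] at hmem
    obtain ⟨w, hw, hw1, he⟩ := mem_tri.1 hmem
    simp only [Matrix.cons_val_zero, Matrix.cons_val_one, Matrix.cons_val] at he
    obtain ⟨e0, e1, e2⟩ : 0 ≤ w 0 ∧ 0 ≤ w 1 ∧ 0 ≤ w 2 := ⟨hw 0, hw 1, hw 2⟩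
    have hz := hV.eq_zero (k := k) (x := (1 + δ / 2) * (1 - θ) - w 1)
      (y := (1 + δ / 2) * θ - w 2) (by
        have hw0 : w 0 = 1 - w 1 - w 2 := by linarith
        rw [hxe, hw0] at he
        linear_combination (norm := module) he)
    nlinarith [hz.1, hz.2]
  have hcases : (∃ k : Fin 3, i = k + 1 ∧ j = k + 2) ∨ (∃ k : Fin 3, j = k + 1 ∧ i = k + 2) := by
    revert i j; decide
  rcases hcases with ⟨k, rfl, rfl⟩ | ⟨k, rfl, rfl⟩
  · exact key k θ h0 h1
  · rw [← AffineMap.lineMap_apply_one_sub]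
    exact key k _ (by linarith) (by linarith)

/-- The edge from `V i` to `V j` is not cut, and lies on the side `ς`. -/
structure EdgeUncut (G : InterfaceDomain) (c : Cut) (τ : Cell) (V : Fin 3 → Plane) (i j : Fin 3)
    (ς : Side) : Prop where
  subset : ∀ θ : ℝ, 0 ≤ θ → θ ≤ 1 → AffineMap.lineMap (V i) (V j) θ ∈ closure (G.sub ς)
  left : c.IsNode τ V ς (V i)
  right : c.IsNode τ V ς (V j)

/-- The interface meets the edge from `V i` to `V j` in one point, with parameter `η`; the part
next to `V i` is on the side `ς` and the part next to `V j` on the other one. -/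
structure EdgeCut (G : InterfaceDomain) (c : Cut) (τ : Cell) (V : Fin 3 → Plane) (i j : Fin 3)
    (η : ℝ) (ς : Side) : Prop where
  pos : 0 < η
  lt_one : η < 1
  mem : AffineMap.lineMap (V i) (V j) η ∈ closure G.Γ
  unique : ∀ θ : ℝ, 0 ≤ θ → θ ≤ 1 → AffineMap.lineMap (V i) (V j) θ ∈ closure G.Γ → θ = η
  subset_left : ∀ θ : ℝ, 0 ≤ θ → θ ≤ η → AffineMap.lineMap (V i) (V j) θ ∈ closure (G.sub ς)
  subset_right : ∀ θ : ℝ, η ≤ θ → θ ≤ 1 →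
    AffineMap.lineMap (V i) (V j) θ ∈ closure (G.sub ς.other)
  left : c.IsNode τ V ς (V i)
  right : c.IsNode τ V ς.other (V j)

/-- An edge is either cut or uncut. -/
def EdgeState (G : InterfaceDomain) (c : Cut) (τ : Cell) (V : Fin 3 → Plane) (i j : Fin 3) :
    Prop :=
  (∃ ς, EdgeUncut G c τ V i j ς) ∨ ∃ η ς, EdgeCut G c τ V i j η ς

section EdgeState

variable {G : InterfaceDomain} {c : Cut} {τ : Cell} {V : Fin 3 → Plane} {i j : Fin 3}

theorem EdgeCut.symm {η : ℝ} {ς : Side} (H : EdgeCut G c τ V i j η ς) :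
    EdgeCut G c τ V j i (1 - η) ς.other where
  pos := by linarith [H.lt_one]
  lt_one := by linarith [H.pos]
  mem := by rw [AffineMap.lineMap_apply_one_sub]; exact H.mem
  unique θ h0 h1 h := by
    have := H.unique (1 - θ) (by linarith) (by linarith)
      (by rwa [AffineMap.lineMap_apply_one_sub])
    linarith
  subset_left θ h0 h1 := by
    rw [← AffineMap.lineMap_apply_one_sub]
    exact H.subset_right _ (by linarith) (by linarith)
  subset_right θ h0 h1 := by
    rw [← AffineMap.lineMap_apply_one_sub, Side.other_other]
    exact H.subset_left _ (by linarith) (by linarith)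
  left := H.right
  right := by rw [Side.other_other]; exact H.left

theorem EdgeState.symm (H : EdgeState G c τ V i j) : EdgeState G c τ V j i := by
  rcases H with ⟨ς, H⟩ | ⟨η, ς, H⟩
  · refine Or.inl ⟨ς, fun θ h0 h1 => ?_, H.right, H.left⟩
    rw [← AffineMap.lineMap_apply_one_sub]
    exact H.subset _ (by linarith) (by linarith)
  · exact Or.inr ⟨_, _, H.symm⟩

theorem edgeState_of_rotation {k : Fin 3} (h1 : EdgeState G c τ V k (k + 1))
    (h2 : EdgeState G c τ V (k + 1) (k + 2)) (h3 : EdgeState G c τ V k (k + 2)) (hij : i ≠ j) :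
    EdgeState G c τ V i j := by
  have hcases : (i = k ∧ j = k + 1) ∨ (i = k + 1 ∧ j = k + 2) ∨ (i = k ∧ j = k + 2) ∨
      (j = k ∧ i = k + 1) ∨ (j = k + 1 ∧ i = k + 2) ∨ (j = k ∧ i = k + 2) := by
    clear h1 h2 h3; revert i j k; decide
  rcases hcases with ⟨rfl, rfl⟩ | ⟨rfl, rfl⟩ | ⟨rfl, rfl⟩ | ⟨rfl, rfl⟩ | ⟨rfl, rfl⟩ | ⟨rfl, rfl⟩
  exacts [h1, h2, h3, h1.symm, h2.symm, h3.symm]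

theorem tri_subset_closure_interior (hi : (interior (tri V)).Nonempty) :
    tri V ⊆ closure (interior (tri V)) := by
  rw [(convex_tri V).closure_interior_eq_closure_of_nonempty_interior hi]
  exact subset_closure

theorem edgeCut_corner_left {k : Fin 3} {s t : ℝ} {d : Bool} {σ : Side} (hV : Nondegenerate V)
    (hc : (Cut.corner k s t d σ).Fits G V) :
    EdgeCut G (Cut.corner k s t d σ) τ V k (k + 1) s σ := by
  obtain ⟨⟨s0, s1⟩, ⟨t0, t1⟩, -, hΓ, h1, h2⟩ := hc
  simp only [Cut.z₄, Cut.z₅] at hΓ h1 h2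
  have hne : k ≠ k + 1 := by clear * -; revert k; decide
  refine ⟨s0, s1, (hΓ.ge (Or.inl rfl)).1, fun θ g0 g1 hθ => ?_, fun θ g0 g1 => ?_,
    fun θ g0 g1 => ?_, ?_, ?_⟩
  · rcases hΓ.le ⟨hθ, hV.lineMap_mem_frontier hne g0 g1⟩ with e | e
    · exact AffineMap.lineMap_injective ℝ (hV.injective.ne hne) e
    · exfalso
      have := hV.eq_zero (k := k) (x := θ) (y := -t) (by
        rw [Set.mem_singleton_iff, AffineMap.lineMap_apply_module', AffineMap.lineMap_apply_module'] at e
        linear_combination (norm := module) e)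
      linarith [this.2]
  · exact h1 (Or.inl (lineMap_mem_segment_left g0 g1))
  · exact h2 (Or.inl (Or.inl (lineMap_mem_segment_right g0 g1)))
  · cases d
    · exact ⟨_, Cut.mem_pieces_corner_false.2 (Or.inl rfl), rfl, 0, rfl⟩
    · exact ⟨_, Cut.mem_pieces_corner_true.2 (Or.inl rfl), rfl, 0, rfl⟩
  · cases d
    · exact ⟨_, Cut.mem_pieces_corner_false.2 (Or.inr (Or.inl rfl)), rfl, 0, rfl⟩
    · exact ⟨_, Cut.mem_pieces_corner_true.2 (Or.inr (Or.inl rfl)), rfl, 0, rfl⟩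

theorem edgeCut_corner_right {k : Fin 3} {s t : ℝ} {d : Bool} {σ : Side} (hV : Nondegenerate V)
    (hc : (Cut.corner k s t d σ).Fits G V) :
    EdgeCut G (Cut.corner k s t d σ) τ V k (k + 2) t σ := by
  obtain ⟨⟨s0, s1⟩, ⟨t0, t1⟩, -, hΓ, h1, h2⟩ := hc
  simp only [Cut.z₄, Cut.z₅] at hΓ h1 h2
  have hne : k ≠ k + 2 := by clear * -; revert k; decide
  refine ⟨t0, t1, (hΓ.ge (Or.inr rfl)).1, fun θ g0 g1 hθ => ?_, fun θ g0 g1 => ?_,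
    fun θ g0 g1 => ?_, ?_, ?_⟩
  · rcases hΓ.le ⟨hθ, hV.lineMap_mem_frontier hne g0 g1⟩ with e | e
    · exfalso
      have := hV.eq_zero (k := k) (x := -s) (y := θ) (by
        rw [AffineMap.lineMap_apply_module', AffineMap.lineMap_apply_module'] at e
        linear_combination (norm := module) e)
      linarith [this.1]
    · exact AffineMap.lineMap_injective ℝ (hV.injective.ne hne) e
  · exact h1 (Or.inr (lineMap_mem_segment_left g0 g1))
  · refine h2 (Or.inr ?_)
    rw [segment_symm]
    exact lineMap_mem_segment_right g0 g1
  · cases d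
    · exact ⟨_, Cut.mem_pieces_corner_false.2 (Or.inl rfl), rfl, 0, rfl⟩
    · exact ⟨_, Cut.mem_pieces_corner_true.2 (Or.inl rfl), rfl, 0, rfl⟩
  · cases d
    · exact ⟨_, Cut.mem_pieces_corner_false.2 (Or.inr (Or.inl rfl)), rfl, 1, rfl⟩
    · exact ⟨_, Cut.mem_pieces_corner_true.2 (Or.inr (Or.inl rfl)), rfl, 1, rfl⟩

theorem edgeCut_through {k : Fin 3} {t : ℝ} {σ : Side} (hV : Nondegenerate V)
    (hc : (Cut.through k t σ).Fits G V) :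
    EdgeCut G (Cut.through k t σ) τ V (k + 1) (k + 2) t σ := by
  obtain ⟨⟨t0, t1⟩, -, hΓ, h1, h2⟩ := hc
  simp only [Cut.z₄, Cut.z₅] at hΓ h1 h2
  have hne : k + 1 ≠ k + 2 := by clear * -; revert k; decide
  refine ⟨t0, t1, (hΓ.ge (Or.inr rfl)).1, fun θ g0 g1 hθ => ?_, fun θ g0 g1 => ?_,
    fun θ g0 g1 => ?_, ?_, ?_⟩
  · rcases hΓ.le ⟨hθ, hV.lineMap_mem_frontier hne g0 g1⟩ with e | e
    · exfalso
      have := hV.eq_zero (k := k) (x := 1 - θ) (y := θ) (by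
        rw [AffineMap.lineMap_apply_module'] at e
        linear_combination (norm := module) e)
      linarith [this.1, this.2]
    · exact AffineMap.lineMap_injective ℝ (hV.injective.ne hne) e
  · exact h1 (Or.inr (lineMap_mem_segment_left g0 g1))
  · refine h2 (Or.inr ?_)
    rw [segment_symm]
    exact lineMap_mem_segment_right g0 g1
  · exact ⟨_, Cut.mem_pieces_through.2 (Or.inl rfl), rfl, 1, rfl⟩
  · exact ⟨_, Cut.mem_pieces_through.2 (Or.inr rfl), rfl, 2, rfl⟩

theorem edgeState_of_fits (hV : Nondegenerate V) (hi : (interior (tri V)).Nonempty)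
    (hc : c.Fits G V) (hij : i ≠ j) : EdgeState G c τ V i j := by
  have hseg : ∀ (p q : Plane) (θ : ℝ), 0 ≤ θ → θ ≤ 1 → AffineMap.lineMap p q θ ∈ segment ℝ p q :=
    fun p q θ h0 h1 => by rw [segment_eq_image_lineMap]; exact ⟨θ, ⟨h0, h1⟩, rfl⟩
  rcases c with σ | ⟨k, s, t, d, σ⟩ | ⟨k, t, σ⟩
  · refine Or.inl ⟨σ, fun θ h0 h1 => ?_, ?_, ?_⟩
    · exact closure_mono hc (tri_subset_closure_interior hi
        (segment_subset_tri V i j (hseg _ _ _ h0 h1)))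
    · exact ⟨_, Cut.mem_pieces_regular.2 rfl, rfl, i, rfl⟩
    · exact ⟨_, Cut.mem_pieces_regular.2 rfl, rfl, j, rfl⟩
  · refine edgeState_of_rotation (k := k) (Or.inr ⟨_, _, edgeCut_corner_left hV hc⟩) (Or.inl
      ⟨σ.other, fun θ h0 h1 => ?_, (edgeCut_corner_left hV hc).right,
        (edgeCut_corner_right hV hc).right⟩) (Or.inr ⟨_, _, edgeCut_corner_right hV hc⟩) hij
    exact hc.2.2.2.2.2 (Or.inl (Or.inr (hseg _ _ _ h0 h1)))
  · refine edgeState_of_rotation (k := k) (Or.inl ⟨σ, fun θ h0 h1 => ?_, ?_,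
      (edgeCut_through hV hc).left⟩) (Or.inr ⟨_, _, edgeCut_through hV hc⟩)
      (Or.inl ⟨σ.other, fun θ h0 h1 => ?_, ?_, (edgeCut_through hV hc).right⟩) hij
    · exact hc.2.2.2.1 (Or.inl (hseg _ _ _ h0 h1))
    · exact ⟨_, Cut.mem_pieces_through.2 (Or.inl rfl), rfl, 0, rfl⟩
    · exact hc.2.2.2.2 (Or.inl (hseg _ _ _ h0 h1))
    · exact ⟨_, Cut.mem_pieces_through.2 (Or.inr rfl), rfl, 0, rfl⟩

/-- An interface element has a cut edge. -/
theorem exists_edgeCut (hV : Nondegenerate V) (hc : c.Fits G V) (hI : c.IsInterface) :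
    ∃ i j, i ≠ j ∧ ∃ η ς, EdgeCut G c τ V i j η ς := by
  rcases c with σ | ⟨k, s, t, d, σ⟩ | ⟨k, t, σ⟩
  · exact hI.elim
  · exact ⟨k, k + 1, by clear * -; revert k; decide, _, _, edgeCut_corner_left hV hc⟩
  · exact ⟨k + 1, k + 2, by clear * -; revert k; decide, _, _, edgeCut_through hV hc⟩

theorem EdgeState.isNode_left_of_mem {σ : Side} (H : EdgeState G c τ V i j)
    (hσ : V i ∈ G.sub σ) : c.IsNode τ V σ (V i) := by
  rcases H with ⟨ς, H⟩ | ⟨η, ς, H⟩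
  · have h1 := H.subset 0 le_rfl zero_le_one
    rw [AffineMap.lineMap_apply_zero] at h1
    rw [G.eq_of_mem_closure hσ h1]; exact H.left
  · have h1 := H.subset_left 0 le_rfl H.pos.le
    rw [AffineMap.lineMap_apply_zero] at h1
    rw [G.eq_of_mem_closure hσ h1]; exact H.left

/-- For a point of an edge on the side `σ`, the end `V i` of the edge is on the side `σ`, or the
interface separates it from the point and the other end is on the side `σ`. -/
theorem EdgeState.isNode_or {σ : Side} (H : EdgeState G c τ V i j) {θ : ℝ} (h0 : 0 < θ)
    (h1 : θ < 1) (hσ : AffineMap.lineMap (V i) (V j) θ ∈ G.sub σ) :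
    c.IsNode τ V σ (V i) ∨ (c.IsNode τ V σ (V j) ∧ ∃ η, 0 < η ∧ η < θ ∧
      AffineMap.lineMap (V i) (V j) η ∈ closure G.Γ ∧
      ∀ θ' : ℝ, 0 ≤ θ' → θ' ≤ 1 → AffineMap.lineMap (V i) (V j) θ' ∈ closure G.Γ → θ' = η) := by
  rcases H with ⟨ς, H⟩ | ⟨η, ς, H⟩
  · rw [G.eq_of_mem_closure hσ (H.subset θ h0.le h1.le)]; exact Or.inl H.left
  · rcases lt_trichotomy θ η with hθ | hθ | hθ
    · rw [G.eq_of_mem_closure hσ (H.subset_left θ h0.le hθ.le)]; exact Or.inl H.left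
    · exact absurd (hθ ▸ H.mem) (G.notMem_closure_Γ hσ)
    · rw [G.eq_of_mem_closure hσ (H.subset_right θ hθ.le h1.le)]
      exact Or.inr ⟨H.right, η, H.pos, hθ, H.mem, H.unique⟩

end EdgeState

namespace CutMesh

variable {G : InterfaceDomain} {a b : Plane} {h : ℝ} {M : CutMesh G a b h}

theorem nondegenerate_vert (hc : cross a b ≠ 0) (hh : h ≠ 0) (τ : Cell) :
    Nondegenerate (M.vert τ) := by
  intro k
  have key : cross (M.vert τ (k + 1) - M.vert τ k) (M.vert τ (k + 2) - M.vert τ k) =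
      h ^ 2 * cross a b ∨
      cross (M.vert τ (k + 1) - M.vert τ k) (M.vert τ (k + 2) - M.vert τ k) =
      -(h ^ 2 * cross a b) := by
    obtain ⟨i, j, d⟩ := τ
    cases d
    · left; fin_cases k <;> simp [vert, cellVert, cross] <;> ring
    · right; fin_cases k <;> simp [vert, cellVert, cross] <;> ring
  have hne : h ^ 2 * cross a b ≠ 0 := mul_ne_zero (pow_ne_zero 2 hh) hc
  rcases key with e | e <;> rw [e]
  exacts [hne, neg_ne_zero.2 hne]

theorem edgeState (hc : cross a b ≠ 0) (hh : h ≠ 0) {τ : Cell} (hτ : τ ∈ M.cells) {i j : Fin 3}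
    (hij : i ≠ j) : EdgeState G (M.cut τ) τ (M.vert τ) i j :=
  edgeState_of_fits (nondegenerate_vert hc hh τ) (interior_tri_cell_nonempty hc hh τ)
    (M.fits τ hτ) hij

/-- `p` is a vertex of a triangle of the body-fitted mesh on the side `σ` in the element `τ`. -/
def IsNode (M : CutMesh G a b h) (τ : Cell) (σ : Side) (p : Plane) : Prop :=
  (M.cut τ).IsNode τ (M.vert τ) σ p

theorem isNode_vert (hc : cross a b ≠ 0) (hh : h ≠ 0) {τ : Cell} (hτ : τ ∈ M.cells) {i : Fin 3}
    {σ : Side} (hσ : M.vert τ i ∈ G.sub σ) : M.IsNode τ σ (M.vert τ i) :=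
  (M.edgeState hc hh hτ (by clear * -; revert i; decide : i ≠ i + 1)).isNode_left_of_mem hσ

/-- An element that meets `Ω^σ` has a vertex on the side `σ`. -/
theorem exists_isNode (hc : cross a b ≠ 0) (hh : h ≠ 0) {τ : Cell} (hτ : τ ∈ M.cells) {x : Plane}
    {σ : Side} (hx : x ∈ tri (M.vert τ)) (hσ : x ∈ G.sub σ) : ∃ p, M.IsNode τ σ p := by
  by_cases hI : (M.cut τ).IsInterface
  · obtain ⟨i, j, -, η, ς, H⟩ :=
      exists_edgeCut (τ := τ) (nondegenerate_vert hc hh τ) (M.fits τ hτ) hI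
    rcases Side.eq_or_eq_other σ ς with rfl | rfl
    exacts [⟨_, H.left⟩, ⟨_, H.right⟩]
  · have hf := M.fits τ hτ
    unfold IsNode
    cases hcut : M.cut τ with
    | regular ς =>
      rw [hcut] at hf
      have hcl := closure_mono hf (tri_subset_closure_interior (interior_tri_cell_nonempty hc hh τ) hx)
      rw [G.eq_of_mem_closure hσ hcl]
      exact ⟨_, _, Cut.mem_pieces_regular.2 rfl, rfl, 0, rfl⟩
    | corner => rw [hcut] at hI; exact absurd trivial hI
    | through => rw [hcut] at hI; exact absurd trivial hI

/-- Two elements with a common point in `Ω^σ` have a common vertex on the side `σ`. -/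
theorem exists_common_isNode (hc : cross a b ≠ 0) (hh : h ≠ 0) {τ τ' : Cell} (hτ : τ ∈ M.cells)
    (hτ' : τ' ∈ M.cells) {x : Plane} {σ : Side} (hx : x ∈ tri (M.vert τ))
    (hx' : x ∈ tri (M.vert τ')) (hσ : x ∈ G.sub σ) : ∃ p, M.IsNode τ σ p ∧ M.IsNode τ' σ p := by
  obtain ⟨w, hw, hw1, hxw⟩ := mem_tri.1 hx
  have hstar : ∀ k, 0 < w k → ∃ l, cellIdx τ' l = cellIdx τ k := fun k hk =>
    exists_cellIdx_eq_of_mem_star hc hh hx' (hxw ▸ mem_star_of_pos hc hh hw hw1 hk)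
  have hcommon : ∀ k, 0 < w k → ∃ l, M.vert τ k = M.vert τ' l := fun k hk => by
    obtain ⟨l, hl⟩ := hstar k hk
    exact ⟨l, (cellVert_inj hc hh).2 hl.symm⟩
  by_cases hall : ∀ k, 0 < w k
  · have : τ = τ' := cell_eq_of_vertices fun k => by
      obtain ⟨l, hl⟩ := hstar k (hall k)
      exact ⟨l, hl.symm⟩
    subst this
    obtain ⟨p, hp⟩ := exists_isNode hc hh hτ hx hσ
    exact ⟨p, hp, hp⟩
  push Not at hall
  obtain ⟨k, hk⟩ := hall
  have hk0 : w k = 0 := le_antisymm hk (hw k)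
  obtain ⟨i, j, hij, hsum, hxe⟩ : ∃ i j, i ≠ j ∧ w i + w j = 1 ∧
      x = w i • M.vert τ i + w j • M.vert τ j := by
    refine ⟨k + 1, k + 2, by clear * -; revert k; decide, ?_, ?_⟩
    · fin_cases k <;> simp at hk0 ⊢ <;> linarith
    · rw [hxw]; fin_cases k <;> simp at hk0 ⊢ <;> rw [hk0] <;> simp [add_comm]
  -- The case of a point that is a vertex.
  have hvert : ∀ k, x = M.vert τ k → 0 < w k → ∃ p, M.IsNode τ σ p ∧ M.IsNode τ' σ p := by
    intro k e hpos
    obtain ⟨l, hl⟩ := hcommon k hpos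
    rw [e] at hσ
    refine ⟨M.vert τ k, isNode_vert hc hh hτ hσ, ?_⟩
    rw [hl] at hσ ⊢
    exact isNode_vert hc hh hτ' hσ
  rcases (hw j).eq_or_lt with hj | hj
  · have hi : w i = 1 := by linarith
    exact hvert i (by rw [hxe, hi, ← hj]; simp) (by linarith)
  rcases (hw i).eq_or_lt with hi | hi
  · have hj1 : w j = 1 := by linarith
    exact hvert j (by rw [hxe, hj1, ← hi]; simp) hj
  -- The point is inside an edge of both elements.
  obtain ⟨i', hi'⟩ := hcommon i hi
  obtain ⟨j', hj'⟩ := hcommon j hj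
  have hij' : i' ≠ j' := by
    rintro rfl
    exact hij ((nondegenerate_vert (M := M) hc hh τ).injective (hi'.trans hj'.symm))
  have hx1 : x = AffineMap.lineMap (M.vert τ i) (M.vert τ j) (w j) := by
    rw [AffineMap.lineMap_apply_module, hxe, ← hsum]; simp
  have hx2 : x = AffineMap.lineMap (M.vert τ j) (M.vert τ i) (w i) := by
    rw [AffineMap.lineMap_apply_module, hxe, ← hsum]; simp [add_comm]
  have flip : ∀ θ : ℝ, AffineMap.lineMap (M.vert τ i) (M.vert τ j) (1 - θ) =
      AffineMap.lineMap (M.vert τ j) (M.vert τ i) θ :=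
    fun θ => AffineMap.lineMap_apply_one_sub _ _ _
  have A1 := (M.edgeState hc hh hτ hij).isNode_or hj (by linarith) (hx1 ▸ hσ)
  have A2 := (M.edgeState hc hh hτ hij.symm).isNode_or hi (by linarith) (hx2 ▸ hσ)
  have B1 := (M.edgeState hc hh hτ' hij').isNode_or hj (by linarith)
    (by rw [← hi', ← hj', ← hx1]; exact hσ)
  have B2 := (M.edgeState hc hh hτ' hij'.symm).isNode_or hi (by linarith)
    (by rw [← hi', ← hj', ← hx2]; exact hσ)
  rw [← hi', ← hj'] at B1 B2
  -- If no end is common, the interface meets the edge on both sides of `x`, against uniqueness.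
  rcases A1 with A1 | ⟨A1, η, -, g2, -, g4⟩
  · rcases B1 with B1 | ⟨B1, η, g1, g2, g3, -⟩
    · exact ⟨_, A1, B1⟩
    rcases A2 with A2 | ⟨-, η', -, f2, -, f4⟩
    · exact ⟨_, A2, B1⟩
    · exfalso
      have := f4 (1 - η) (by linarith) (by linarith) (by rw [← flip, sub_sub_cancel]; exact g3)
      linarith
  · rcases B2 with B2 | ⟨B2, η', f1, f2, f3, -⟩
    · exact ⟨_, A1, B2⟩
    · exfalso
      have := g4 (1 - η') (by linarith) (by linarith) (by rw [flip]; exact f3)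
      linarith

/-- An element with a vertex on the side `σ` meets `Ω^σ`. -/
theorem exists_mem_sub_of_isNode (hc : cross a b ≠ 0) (hh : h ≠ 0) {τ : Cell} (hτ : τ ∈ M.cells)
    {σ : Side} {p : Plane} (hp : M.IsNode τ σ p) : ∃ x ∈ tri (M.vert τ), x ∈ G.sub σ := by
  by_cases hI : (M.cut τ).IsInterface
  swap
  · have hf := M.fits τ hτ
    unfold IsNode at hp
    cases hcut : M.cut τ with
    | regular ς =>
      rw [hcut] at hf hp
      obtain ⟨T, hT, rfl, -⟩ := hp
      rw [Cut.mem_pieces_regular] at hT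
      subst hT
      obtain ⟨x, hx⟩ := interior_tri_cell_nonempty (o := M.o) hc hh τ
      exact ⟨x, interior_subset hx, hf hx⟩
    | corner => rw [hcut] at hI; exact absurd trivial hI
    | through => rw [hcut] at hI; exact absurd trivial hI
  obtain ⟨i, j, hij, η, ς, H⟩ :=
    exists_edgeCut (τ := τ) (nondegenerate_vert hc hh τ) (M.fits τ hτ) hI
  -- A point inside the edge, on the side `σ` of the interface.
  obtain ⟨θ, h0, h1, hcl, hΓ⟩ : ∃ θ : ℝ, 0 < θ ∧ θ < 1 ∧
      AffineMap.lineMap (M.vert τ i) (M.vert τ j) θ ∈ closure (G.sub σ) ∧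
      AffineMap.lineMap (M.vert τ i) (M.vert τ j) θ ∉ closure G.Γ := by
    have g0 := H.pos
    have g1 := H.lt_one
    rcases Side.eq_or_eq_other σ ς with rfl | rfl
    · refine ⟨η / 2, by linarith, by linarith, H.subset_left _ (by linarith) (by linarith), ?_⟩
      intro hm
      linarith [H.unique _ (by linarith) (by linarith) hm]
    · refine ⟨(1 + η) / 2, by linarith, by linarith,
        H.subset_right _ (by linarith) (by linarith), ?_⟩
      intro hm
      linarith [H.unique _ (by linarith) (by linarith) hm]
  set q : Plane := AffineMap.lineMap (M.vert τ i) (M.vert τ j) θ with hq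
  have hqτ : q ∈ tri (M.vert τ) := segment_subset_tri _ i j (by
    rw [segment_eq_image_lineMap]; exact ⟨θ, ⟨h0.le, h1.le⟩, rfl⟩)
  by_contra! hno
  -- Close to `q` there are only the element and its neighbour across the edge.
  set U := IFEM.star M.o a b h (cellIdx τ i) ∩ IFEM.star M.o a b h (cellIdx τ j) with hU
  have hUo : IsOpen U := (isOpen_star _).inter (isOpen_star _)
  have hqU : q ∈ U := by
    have hq' : q = (1 - θ) • M.vert τ i + θ • M.vert τ j := AffineMap.lineMap_apply_module _ _ _
    obtain ⟨w, hw, hw1, hwi, hwj, hqw⟩ : ∃ w : Fin 3 → ℝ, (∀ k, 0 ≤ w k) ∧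
        w 0 + w 1 + w 2 = 1 ∧ 0 < w i ∧ 0 < w j ∧
        q = w 0 • M.vert τ 0 + w 1 • M.vert τ 1 + w 2 • M.vert τ 2 := by
      refine ⟨fun k => if k = i then 1 - θ else if k = j then θ else 0, fun k => ?_, ?_, ?_, ?_, ?_⟩
      · dsimp only; split_ifs <;> linarith
      · fin_cases i <;> fin_cases j <;> first | exact absurd rfl hij | simp
      · simp; linarith
      · simp [hij.symm, h0]
      · rw [hq']
        fin_cases i <;> fin_cases j <;> first | exact absurd rfl hij | simp [add_comm]
    rw [hqw]
    exact ⟨mem_star_of_pos hc hh hw hw1 hwi, mem_star_of_pos hc hh hw hw1 hwj⟩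
  have hidx : cellIdx τ i ≠ cellIdx τ j := (cellIdx_injective τ).ne hij
  obtain ⟨y, hyU, hyσ⟩ := mem_closure_iff.1 hcl U hUo hqU
  have hyΩ : y ∈ ⋃ τ' ∈ M.cells, tri (cellVert M.o a b h τ') := by
    rw [M.covers]; exact subset_closure (G.sub_subset σ hyσ)
  simp only [Set.mem_iUnion, exists_prop] at hyΩ
  obtain ⟨τ₂, hτ₂, hyτ₂⟩ := hyΩ
  have hne : τ ≠ τ₂ := by rintro rfl; exact hno y hyτ₂ hyσ
  have hUsub : U ⊆ tri (M.vert τ) ∪ tri (M.vert τ₂) := by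
    intro y' hy'
    obtain ⟨τ₃, hy'3⟩ := exists_mem_tri_cell (o := M.o) hc hh y'
    obtain ⟨k₂, e₂⟩ := exists_cellIdx_eq_of_mem_star hc hh hyτ₂ hyU.1
    obtain ⟨l₂, f₂⟩ := exists_cellIdx_eq_of_mem_star hc hh hyτ₂ hyU.2
    obtain ⟨k₃, e₃⟩ := exists_cellIdx_eq_of_mem_star hc hh hy'3 hy'.1
    obtain ⟨l₃, f₃⟩ := exists_cellIdx_eq_of_mem_star hc hh hy'3 hy'.2
    have hb : τ.2.2 ≠ τ₂.2.2 := fun e => hne (cell_eq_of_common_edge e hij e₂.symm f₂.symm)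
    by_cases hb3 : τ.2.2 = τ₃.2.2
    · rw [← cell_eq_of_common_edge hb3 hij e₃.symm f₃.symm] at hy'3
      exact Or.inl hy'3
    · have hb4 : τ₂.2.2 = τ₃.2.2 := by
        revert hb hb3; cases τ.2.2 <;> cases τ₂.2.2 <;> cases τ₃.2.2 <;> simp
      have hkl : k₂ ≠ l₂ := by rintro rfl; exact hidx (e₂.symm.trans f₂)
      rw [← cell_eq_of_common_edge hb4 hkl (e₂.trans e₃.symm) (f₂.trans f₃.symm)] at hy'3
      exact Or.inr hy'3
  have hqΩ : q ∈ G.Ω := by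
    rw [← G.regular, ← M.covers]
    refine mem_interior.2 ⟨U, hUsub.trans ?_, hUo, hqU⟩
    refine Set.union_subset ?_ ?_
    · exact Set.subset_biUnion_of_mem (u := fun τ => tri (cellVert M.o a b h τ)) hτ
    · exact Set.subset_biUnion_of_mem (u := fun τ => tri (cellVert M.o a b h τ)) hτ₂
  exact hno q hqτ (G.mem_sub_of_mem_closure hqΩ hΓ hcl)

/-- The vertices on one side in one element are within two layers of each other. -/
theorem mem_layers_of_isNode {τ : Cell} (hτ : τ ∈ M.cells) {σ : Side} {z p q : Plane} {n : ℕ}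
    (hp : M.IsNode τ σ p) (hq : M.IsNode τ σ q) (hpn : p ∈ M.layers σ z n) :
    q ∈ M.layers σ z (n + 2) := by
  obtain ⟨T, hT, hTσ, k, rfl⟩ := hp
  obtain ⟨T', hT', hTσ', k', rfl⟩ := hq
  have hf : ∀ T ∈ (M.cut τ).pieces τ (M.vert τ), T ∈ M.fine := by
    intro T hT
    obtain rfl := Cut.cell_of_mem_pieces hT
    exact M.mem_fine.2 ⟨hτ, hT⟩
  obtain ⟨i, j, hij⟩ := Cut.exists_common_vertex hT hT'
  have h1 : T.vert i ∈ M.layers σ z (n + 1) :=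
    mem_layers_succ.2 (Or.inr ⟨T, hf T hT, hTσ, ⟨k, hpn⟩, i, rfl⟩)
  exact mem_layers_succ.2 (Or.inr ⟨T', hf T' hT', hTσ', ⟨j, hij ▸ h1⟩, k', rfl⟩)

theorem layers_mono {σ : Side} {z : Plane} {m n : ℕ} (hmn : m ≤ n) :
    M.layers σ z m ⊆ M.layers σ z n := by
  induction hmn with
  | refl => exact subset_rfl
  | step _ ih => exact ih.trans fun x hx => mem_layers_succ.2 (Or.inl hx)

end CutMesh

/-! ### Unisolvence of quadratic polynomials on a lattice triangle -/

/-- The lattice coordinates of the six points of a lattice triangle of side two. -/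
def stencil : Fin 6 → ℕ × ℕ := ![(0, 0), (1, 0), (0, 1), (2, 0), (1, 1), (0, 2)]

theorem stencil_le (k : Fin 6) : (stencil k).1 ≤ 2 ∧ (stencil k).2 ≤ 2 := by
  revert k; decide

/-- A quadratic polynomial that vanishes at the six points of a lattice triangle of side two is
zero. -/
theorem eq_zero_of_quad_stencil_eq_zero {a b y : Plane} (hc : cross a b ≠ 0) {c : Fin 6 → ℝ}
    (H : ∀ k, quad c (y + ((stencil k).1 : ℝ) • a + ((stencil k).2 : ℝ) • b) = 0) : c = 0 := by
  have h0 := H 0; have h1 := H 1; have h2 := H 2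
  have h3 := H 3; have h4 := H 4; have h5 := H 5
  simp [stencil, quad] at h0 h1 h2 h3 h4 h5
  have hc2 : cross a b ^ 2 ≠ 0 := pow_ne_zero 2 hc
  -- The quadratic part on `a`, its polar form on `a` and `b`, and the quadratic part on `b`.
  have hD : c 3 * a 0 ^ 2 + c 4 * (a 0 * a 1) + c 5 * a 1 ^ 2 = 0 := by
    linear_combination h3 / 2 - h1 + h0 / 2
  have hF : c 3 * b 0 ^ 2 + c 4 * (b 0 * b 1) + c 5 * b 1 ^ 2 = 0 := by
    linear_combination h5 / 2 - h2 + h0 / 2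
  have hE : 2 * c 3 * (a 0 * b 0) + c 4 * (a 0 * b 1 + a 1 * b 0) + 2 * c 5 * (a 1 * b 1) = 0 := by
    linear_combination h4 - h1 - h2 + h0
  have e3 : c 3 = 0 := by
    refine (mul_eq_zero.1 ?_).resolve_left hc2
    unfold cross
    linear_combination b 1 ^ 2 * hD - a 1 * b 1 * hE + a 1 ^ 2 * hF
  have e5 : c 5 = 0 := by
    refine (mul_eq_zero.1 ?_).resolve_left hc2
    unfold cross
    linear_combination b 0 ^ 2 * hD - a 0 * b 0 * hE + a 0 ^ 2 * hF
  have e4 : c 4 = 0 := by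
    refine (mul_eq_zero.1 ?_).resolve_left hc2
    unfold cross
    linear_combination -2 * b 0 * b 1 * hD + (a 0 * b 1 + a 1 * b 0) * hE - 2 * a 0 * a 1 * hF
  simp only [e3, e4, e5, zero_mul, add_zero] at h0 h1 h2
  have e1 : c 1 = 0 := by
    refine (mul_eq_zero.1 ?_).resolve_left hc
    unfold cross
    linear_combination b 1 * (h1 - h0) - a 1 * (h2 - h0)
  have e2 : c 2 = 0 := by
    refine (mul_eq_zero.1 ?_).resolve_left hc
    unfold cross
    linear_combination a 0 * (h2 - h0) - b 0 * (h1 - h0)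
  simp only [e1, e2, zero_mul, add_zero] at h0
  funext k
  fin_cases k <;> assumption

theorem quad_smul (s : ℝ) (c : Fin 6 → ℝ) (y : Plane) : quad (s • c) y = s * quad c y := by
  simp [quad]; ring

/-- The fit on a lattice triangle of side two is well conditioned, uniformly in bounded positions
of the triangle: a compactness argument. -/
theorem exists_stencil_bound {a b : Plane} (hc : cross a b ≠ 0) {R : ℝ} (hR : 0 ≤ R) :
    ∃ κ : ℝ, 0 < κ ∧ ∀ y : Plane, ‖y‖ ≤ R → ∀ c : Fin 6 → ℝ, κ * ∑ i, c i ^ 2 ≤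
      ∑ k, quad c (y + ((stencil k).1 : ℝ) • a + ((stencil k).2 : ℝ) • b) ^ 2 := by
  set f : Plane × (Fin 6 → ℝ) → ℝ := fun p =>
    ∑ k, quad p.2 (p.1 + ((stencil k).1 : ℝ) • a + ((stencil k).2 : ℝ) • b) ^ 2 with hf
  have hfc : Continuous f := by
    unfold f quad
    fun_prop
  set S : Set (Fin 6 → ℝ) := {c | ∑ i, c i ^ 2 = 1} with hS
  have hSc : IsCompact S := by
    refine Metric.isCompact_of_isClosed_isBounded ?_ ?_
    · exact isClosed_eq (by fun_prop) continuous_const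
    · refine Metric.isBounded_closedBall.subset (t := Metric.closedBall 0 1) fun c hc => ?_
      rw [mem_closedBall_zero_iff, pi_norm_le_iff_of_nonneg zero_le_one]
      intro i
      have h1 : c i ^ 2 ≤ 1 := by
        have h2 : ∑ i, c i ^ 2 = 1 := hc
        rw [← h2]
        exact Finset.single_le_sum (f := fun i => c i ^ 2) (fun j _ => sq_nonneg _)
          (Finset.mem_univ i)
      rw [Real.norm_eq_abs]
      exact (sq_le_one_iff_abs_le_one _).1 h1
  have hne : (Metric.closedBall (0 : Plane) R ×ˢ S).Nonempty :=
    ⟨(0, Pi.single 0 1), by simp [hR], by simp [hS, Fin.sum_univ_six]⟩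
  obtain ⟨⟨y₀, c₀⟩, ⟨-, hc₀⟩, hmin⟩ :=
    ((isCompact_closedBall (0 : Plane) R).prod hSc).exists_isMinOn hne hfc.continuousOn
  refine ⟨f (y₀, c₀), ?_, fun y hy c => ?_⟩
  · have h0 : 0 ≤ f (y₀, c₀) := Finset.sum_nonneg fun k _ => sq_nonneg _
    refine lt_of_le_of_ne h0 fun e => ?_
    have hz : ∀ k, quad c₀ (y₀ + ((stencil k).1 : ℝ) • a + ((stencil k).2 : ℝ) • b) = 0 := by
      intro k
      have := (Finset.sum_eq_zero_iff_of_nonneg fun k _ => sq_nonneg _).1 e.symm k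
        (Finset.mem_univ k)
      exact pow_eq_zero_iff two_ne_zero |>.1 this
    have h1 : ∑ i, c₀ i ^ 2 = 1 := hc₀
    rw [eq_zero_of_quad_stencil_eq_zero hc hz] at h1
    simp at h1
  · have hs0 : 0 ≤ ∑ i, c i ^ 2 := Finset.sum_nonneg fun i _ => sq_nonneg _
    rcases hs0.eq_or_lt with hs | hs
    · rw [← hs, mul_zero]; exact Finset.sum_nonneg fun k _ => sq_nonneg _
    set s := ∑ i, c i ^ 2 with hsdef
    have hs2 : (√s)⁻¹ ^ 2 = s⁻¹ := by rw [inv_pow, Real.sq_sqrt hs0]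
    have hmem : ((√s)⁻¹ • c) ∈ S := by
      simp only [hS, Set.mem_ofPred_eq, Pi.smul_apply, smul_eq_mul, mul_pow, hs2]
      rw [← Finset.mul_sum, ← hsdef, inv_mul_cancel₀ hs.ne']
    have h1 : f (y₀, c₀) ≤ f (y, (√s)⁻¹ • c) :=
      hmin ⟨by simpa using hy, hmem⟩
    have h2 : f (y, (√s)⁻¹ • c) = s⁻¹ * f (y, c) := by
      simp only [hf, quad_smul, mul_pow, hs2, Finset.mul_sum]
    rw [h2, inv_mul_eq_div, le_div_iff₀ hs] at h1
    exact h1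

/-! ### Existence of well-conditioned patches -/

namespace CutMesh

variable {G : InterfaceDomain} {a b : Plane} {h : ℝ} {M : CutMesh G a b h}

theorem exists_cell_of_mem_sub {σ : Side} {x : Plane} (hx : x ∈ G.sub σ) :
    ∃ τ ∈ M.cells, x ∈ tri (M.vert τ) := by
  have hxΩ : x ∈ ⋃ τ ∈ M.cells, tri (cellVert M.o a b h τ) := by
    rw [M.covers]; exact subset_closure (G.sub_subset σ hx)
  simp only [Set.mem_iUnion, exists_prop] at hxΩ
  exact hxΩ

open Classical in
/-- The layers around `z` reach every element that meets a connected subset of `Ω^σ`, after a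
number of steps bounded by the number of elements that may meet the set. -/
theorem mem_layers_of_isPreconnected (hc : cross a b ≠ 0) (hh : h ≠ 0) {σ : Side} {z : Plane}
    {S : Set Plane} (hS : S ⊆ G.sub σ) (hconn : IsPreconnected S) {τ₀ : Cell} (hτ₀ : τ₀ ∈ M.cells)
    (hne : (tri (M.vert τ₀) ∩ S).Nonempty) {m n₀ : ℕ}
    (hnear : ∀ τ ∈ M.cells, (tri (M.vert τ) ∩ S).Nonempty → τ ∈ nearCells m τ₀)
    (hz : ∀ p, M.IsNode τ₀ σ p → p ∈ M.layers σ z n₀) :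
    ∀ τ ∈ M.cells, (tri (M.vert τ) ∩ S).Nonempty → ∀ p, M.IsNode τ σ p →
      p ∈ M.layers σ z (n₀ + 2 * nearCount m) := by
  set F := M.cells.filter fun τ => (tri (M.vert τ) ∩ S).Nonempty with hF
  set R : ℕ → Finset Cell := fun n =>
    F.filter fun τ => ∀ p, M.IsNode τ σ p → p ∈ M.layers σ z (n₀ + 2 * n) with hR
  have hRF : ∀ n, R n ⊆ F := fun n => Finset.filter_subset _ _
  have hmono : ∀ n, R n ⊆ R (n + 1) := fun n τ hτ => by
    obtain ⟨h1, h2⟩ := Finset.mem_filter.1 hτ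
    exact Finset.mem_filter.2 ⟨h1, fun p hp => layers_mono (by omega) (h2 p hp)⟩
  have h0R : ∀ n, τ₀ ∈ R n := fun n => Finset.mem_filter.2
    ⟨Finset.mem_filter.2 ⟨hτ₀, hne⟩, fun p hp => layers_mono (by omega) (hz p hp)⟩
  -- As long as some element is missing, one that touches a reached element is added.
  have hgrow : ∀ n, R n = F ∨ n + 1 ≤ (R n).card := by
    intro n
    induction n with
    | zero => exact Or.inr (Finset.card_pos.2 ⟨τ₀, h0R 0⟩)
    | succ n ih =>
      rcases ih with ih | ih
      · exact Or.inl (subset_antisymm (hRF _) (ih ▸ hmono n))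
      by_cases hfull : R n = F
      · exact Or.inl (subset_antisymm (hRF _) (hfull ▸ hmono n))
      refine Or.inr ?_
      obtain ⟨τ', hτ'F, hτ'R⟩ : ∃ τ' ∈ F, τ' ∉ R n := by
        by_contra! H
        exact hfull (subset_antisymm (hRF n) H)
      have hclosed : ∀ A : Finset Cell, IsClosed (⋃ τ ∈ A, tri (M.vert τ)) := fun A =>
        A.finite_toSet.isClosed_biUnion fun τ _ => isClosed_tri _
      have hcov : S ⊆ (⋃ τ ∈ R n, tri (M.vert τ)) ∪ ⋃ τ ∈ F \ R n, tri (M.vert τ) := by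
        intro x hx
        obtain ⟨τ, hτ, hxτ⟩ := M.exists_cell_of_mem_sub (hS hx)
        have hτF : τ ∈ F := Finset.mem_filter.2 ⟨hτ, x, hxτ, hx⟩
        by_cases hτR : τ ∈ R n
        · exact Or.inl (Set.mem_biUnion hτR hxτ)
        · exact Or.inr (Set.mem_biUnion (Finset.mem_sdiff.2 ⟨hτF, hτR⟩) hxτ)
      have hA : (S ∩ ⋃ τ ∈ R n, tri (M.vert τ)).Nonempty := by
        obtain ⟨x, hx1, hx2⟩ := hne
        exact ⟨x, hx2, Set.mem_biUnion (h0R n) hx1⟩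
      have hB : (S ∩ ⋃ τ ∈ F \ R n, tri (M.vert τ)).Nonempty := by
        obtain ⟨x, hx1, hx2⟩ := (Finset.mem_filter.1 hτ'F).2
        exact ⟨x, hx2, Set.mem_biUnion (Finset.mem_sdiff.2 ⟨hτ'F, hτ'R⟩) hx1⟩
      obtain ⟨x, hxS, hx1, hx2⟩ :=
        isPreconnected_closed_iff.1 hconn _ _ (hclosed _) (hclosed _) hcov hA hB
      simp only [Set.mem_iUnion, exists_prop] at hx1 hx2
      obtain ⟨τ₁, hτ₁, hxτ₁⟩ := hx1
      obtain ⟨τ₂, hτ₂, hxτ₂⟩ := hx2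
      obtain ⟨hτ₂F, hτ₂R⟩ := Finset.mem_sdiff.1 hτ₂
      obtain ⟨hτ₁F, hτ₁p⟩ := Finset.mem_filter.1 hτ₁
      have hτ₁c := (Finset.mem_filter.1 hτ₁F).1
      have hτ₂c := (Finset.mem_filter.1 hτ₂F).1
      obtain ⟨p, hp1, hp2⟩ := exists_common_isNode hc hh hτ₁c hτ₂c hxτ₁ hxτ₂ (hS hxS)
      have hnew : τ₂ ∈ R (n + 1) := Finset.mem_filter.2
        ⟨hτ₂F, fun q hq => mem_layers_of_isNode hτ₂c hp2 hq (hτ₁p p hp1)⟩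
      have : R n ⊂ R (n + 1) := (Finset.ssubset_iff_of_subset (hmono n)).2 ⟨τ₂, hnew, hτ₂R⟩
      have := Finset.card_lt_card this
      omega
  have hcardF : F.card ≤ nearCount m := by
    rw [← card_nearCells m τ₀]
    refine Finset.card_le_card fun τ hτ => ?_
    obtain ⟨h1, h2⟩ := Finset.mem_filter.1 hτ
    exact hnear τ h1 h2
  have hfin : R (nearCount m) = F := by
    refine (hgrow _).resolve_right fun H => ?_
    have := Finset.card_le_card (hRF (nearCount m))
    omega
  intro τ hτ hτS
  have : τ ∈ R (nearCount m) := hfin ▸ Finset.mem_filter.2 ⟨hτ, hτS⟩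
  exact (Finset.mem_filter.1 this).2

/-- In the cone at a point of `Ω^σ` there is, at a distance of order `h`, a ball that contains a
lattice triangle of side two. The layers around a vertex reach it along the axis of the cone. -/
theorem exists_wellConditioned (hc : cross a b ≠ 0) {σ : Side} (hcone : UniformCone (G.sub σ)) :
    ∃ κ : ℝ, 0 < κ ∧ ∃ N : ℕ, ∃ h₀ : ℝ, 0 < h₀ ∧ ∀ h : ℝ, 0 < h → h < h₀ →
      ∀ M : CutMesh G a b h, ∀ z ∈ M.nodes σ, WellConditioned κ h z (M.layers σ z N) := by
  obtain ⟨r, hr, δ, hδ, hcone⟩ := hcone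
  set ρ := 2 * (‖a‖ + ‖b‖) with hρ
  have hρ0 : 0 ≤ ρ := by positivity
  set L := (ρ + 1) / δ with hL
  have hL0 : 0 < L := by positivity
  have hLδ : δ * L = ρ + 1 := by rw [hL]; field_simp
  obtain ⟨κ, hκ, hκc⟩ := exists_stencil_bound hc (R := ρ + L + ρ) (by positivity)
  set m := ⌈2 * (‖a‖ + ‖b‖) / |cross a b| * (L + ρ) + 1⌉₊ with hm
  refine ⟨κ / 6, by positivity, 2 + 2 * nearCount m, r / L, by positivity, fun h hh hhr M z hz => ?_⟩
  have hLh : L * h < r := by rw [lt_div_iff₀ hL0] at hhr; linarith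
  -- The element `τ₀` of the vertex, and the axis of the cone at a point of `τ₀`.
  obtain ⟨τ₀, hτ₀, hzτ₀, hznode⟩ : ∃ τ₀ ∈ M.cells, z ∈ tri (M.vert τ₀) ∧ M.IsNode τ₀ σ z := by
    simp only [nodes, Finset.mem_biUnion, Finset.mem_filter, Finset.mem_image, Finset.mem_univ,
      true_and] at hz
    obtain ⟨T, ⟨hT, hTσ⟩, k, rfl⟩ := hz
    obtain ⟨h1, h2⟩ := M.mem_fine.1 hT
    exact ⟨T.cell, h1, vert_mem_tri_cell hT k, T, h2, hTσ, k, rfl⟩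
  obtain ⟨x₀, hx₀, hx₀σ⟩ := exists_mem_sub_of_isNode hc hh.ne' hτ₀ hznode
  obtain ⟨ξ, hξ, hball⟩ := hcone x₀ (subset_closure hx₀σ)
  set c₀ : Plane := x₀ + (L * h) • ξ with hc₀
  have hcdist : ‖c₀ - x₀‖ = L * h := by
    rw [hc₀, add_sub_cancel_left, norm_smul, hξ, mul_one, Real.norm_eq_abs,
      abs_of_pos (by positivity)]
  set S : Set Plane := segment ℝ x₀ c₀ ∪ Metric.closedBall c₀ (ρ * h) with hSdef
  have hSσ : S ⊆ G.sub σ := by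
    refine Set.union_subset ?_ ?_
    · rw [segment_eq_image']
      rintro _ ⟨θ, ⟨h0, h1⟩, rfl⟩
      rcases h0.eq_or_lt with rfl | h0
      · simpa using hx₀σ
      · have ht : 0 < θ * (L * h) := by positivity
        refine hball (θ * (L * h)) ht ?_ ?_
        · nlinarith [mul_pos hL0 hh]
        · have e : x₀ + θ • (c₀ - x₀) = x₀ + (θ * (L * h)) • ξ := by
            rw [hc₀, add_sub_cancel_left, smul_smul]
          simp only [e]
          exact Metric.mem_ball_self (by positivity)
    · refine subset_trans (Metric.closedBall_subset_ball ?_) (hball (L * h) (by positivity) hLh)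
      rw [← mul_assoc, hLδ]; nlinarith
  have hSconn : IsPreconnected S := by
    refine IsPreconnected.union c₀ (right_mem_segment ℝ x₀ c₀)
      (Metric.mem_closedBall_self (by positivity)) ?_ ?_
    · exact (convex_segment x₀ c₀).isPreconnected
    · exact (convex_closedBall c₀ (ρ * h)).isPreconnected
  have hSdist : ∀ x ∈ S, ‖x₀ - x‖ ≤ (L + ρ) * h := by
    intro x hx
    rcases hx with hx | hx
    · have h1 := norm_sub_le_of_mem_segment hx
      rw [hcdist] at h1
      rw [norm_sub_rev]
      nlinarith
    · rw [mem_closedBall_iff_norm] at hx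
      have := norm_sub_le_norm_sub_add_norm_sub x₀ c₀ x
      rw [norm_sub_rev x₀ c₀, hcdist, norm_sub_rev c₀ x] at this
      linarith
  have hx₀S : x₀ ∈ S := Or.inl (left_mem_segment ℝ x₀ c₀)
  have hreach := mem_layers_of_isPreconnected (z := z) (m := m) (n₀ := 2) hc hh.ne' hSσ hSconn hτ₀
    ⟨x₀, hx₀, hx₀S⟩ (by
      rintro τ - ⟨x, hxτ, hxS⟩
      refine mem_nearCells_of_dist hc hh hx₀ hxτ (le_trans ?_ (Nat.le_ceil _))
      have : h⁻¹ * ‖x₀ - x‖ ≤ L + ρ := by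
        rw [inv_mul_le_iff₀ hh, mul_comm]; exact hSdist x hxS
      gcongr) (fun p hp => mem_layers_of_isNode hτ₀ hznode hp (mem_layers_zero.2 rfl))
  -- The lattice triangle of side two next to the centre of the ball.
  set i := ⌊latS M.o a b h c₀⌋
  set j := ⌊latT M.o a b h c₀⌋
  have hpt : ∀ k, latPt M.o a b h (i + (stencil k).1) (j + (stencil k).2) ∈
      Metric.closedBall c₀ (ρ * h) := by
    intro k
    rw [mem_closedBall_iff_norm]
    have e : latPt M.o a b h (i + (stencil k).1) (j + (stencil k).2) - c₀ =
        h • ((i + (stencil k).1 - latS M.o a b h c₀) • a +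
          (j + (stencil k).2 - latT M.o a b h c₀) • b) := by
      conv_lhs => rw [← latPt_latS_latT (o := M.o) hc hh.ne' c₀]
      unfold latPt; module
    rw [e, norm_smul, Real.norm_eq_abs, abs_of_pos hh, mul_comm]
    refine mul_le_mul_of_nonneg_right ?_ hh.le
    have hst : ((stencil k).1 : ℝ) ≤ 2 ∧ ((stencil k).2 : ℝ) ≤ 2 := by
      have : (stencil k).1 ≤ 2 ∧ (stencil k).2 ≤ 2 := stencil_le k
      exact_mod_cast this
    have g1 := Int.floor_le (latS M.o a b h c₀)
    have g2 := Int.lt_floor_add_one (latS M.o a b h c₀)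
    have g3 := Int.floor_le (latT M.o a b h c₀)
    have g4 := Int.lt_floor_add_one (latT M.o a b h c₀)
    have g5 : (0 : ℝ) ≤ (stencil k).1 := Nat.cast_nonneg _
    have g6 : (0 : ℝ) ≤ (stencil k).2 := Nat.cast_nonneg _
    refine (norm_add_le _ _).trans ?_
    rw [norm_smul, norm_smul, Real.norm_eq_abs, Real.norm_eq_abs, hρ, mul_add]
    have q1 : |(i : ℝ) + (stencil k).1 - latS M.o a b h c₀| ≤ 2 := by
      rw [abs_le]; constructor <;> linarith [hst.1]
    have q2 : |(j : ℝ) + (stencil k).2 - latT M.o a b h c₀| ≤ 2 := by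
      rw [abs_le]; constructor <;> linarith [hst.2]
    gcongr
  have hlayer : ∀ k, latPt M.o a b h (i + (stencil k).1) (j + (stencil k).2) ∈
      M.layers σ z (2 + 2 * nearCount m) := by
    intro k
    set p := latPt M.o a b h (i + (stencil k).1) (j + (stencil k).2) with hp
    have hpS : p ∈ S := Or.inr (hpt k)
    have hpσ := hSσ hpS
    obtain ⟨τ, hτ, hpτ⟩ := M.exists_cell_of_mem_sub hpσ
    have hpstar : p ∈ IFEM.star M.o a b h (i + (stencil k).1, j + (stencil k).2) := by
      have := latPt_mem_star (o := M.o) hc hh.ne' (i + ((stencil k).1 : ℤ), j + ((stencil k).2 : ℤ))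
      push_cast at this
      exact this
    obtain ⟨l, hl⟩ := exists_cellIdx_eq_of_mem_star hc hh.ne' hpτ hpstar
    have hpe : M.vert τ l = p := by
      rw [vert, cellVert_eq, hl, hp]; push_cast; rfl
    refine hreach τ hτ ⟨p, hpτ, hpS⟩ p ?_
    rw [← hpe] at hpσ ⊢
    exact isNode_vert hc hh.ne' hτ hpσ
  -- The conditioning of the fit.
  intro c
  set y₀ : Plane := h⁻¹ • (latPt M.o a b h i j - z) with hy₀
  have hy₀R : ‖y₀‖ ≤ ρ + L + ρ := by
    rw [hy₀, norm_smul, norm_inv, Real.norm_eq_abs, abs_of_pos hh, inv_mul_le_iff₀ hh]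
    have h1 : ‖latPt M.o a b h i j - c₀‖ ≤ ρ * h := by
      simpa [stencil] using mem_closedBall_iff_norm.1 (hpt 0)
    have h2 : ‖x₀ - z‖ ≤ ρ * h := dist_le_of_mem_tri_cell hh hx₀ hzτ₀
    calc ‖latPt M.o a b h i j - z‖
        = ‖(latPt M.o a b h i j - c₀) + (c₀ - x₀) + (x₀ - z)‖ := by congr 1; abel
      _ ≤ ‖latPt M.o a b h i j - c₀‖ + ‖c₀ - x₀‖ + ‖x₀ - z‖ := norm_add₃_le
      _ ≤ h * (ρ + L + ρ) := by rw [hcdist]; linarith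
  have hpts : ∀ k, y₀ + ((stencil k).1 : ℝ) • a + ((stencil k).2 : ℝ) • b =
      h⁻¹ • (latPt M.o a b h (i + (stencil k).1) (j + (stencil k).2) - z) := by
    intro k
    have e : latPt M.o a b h (i + (stencil k).1) (j + (stencil k).2) - z =
        (latPt M.o a b h i j - z) + h • (((stencil k).1 : ℝ) • a + ((stencil k).2 : ℝ) • b) := by
      unfold latPt; module
    rw [e, smul_add, smul_smul, inv_mul_cancel₀ hh.ne', one_smul, hy₀, add_assoc]
  have hfin : ∑ k, quad c (y₀ + ((stencil k).1 : ℝ) • a + ((stencil k).2 : ℝ) • b) ^ 2 ≤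
      6 * ∑ x ∈ M.layers σ z (2 + 2 * nearCount m), quad c (h⁻¹ • (x - z)) ^ 2 := by
    refine (Finset.sum_le_card_nsmul _ _
      (∑ x ∈ M.layers σ z (2 + 2 * nearCount m), quad c (h⁻¹ • (x - z)) ^ 2) fun k _ => ?_).trans
      (by simp)
    rw [hpts k]
    exact Finset.single_le_sum (f := fun x => quad c (h⁻¹ • (x - z)) ^ 2)
      (fun x _ => sq_nonneg _) (hlayer k)
  have := hκc y₀ hy₀R c
  linarith

end CutMesh

end IFEM

theorem mainTheorem3 (G : IFEM.InterfaceDomain)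
    (hcone : ∀ σ, IFEM.UniformCone (G.sub σ))
    (a b : IFEM.Plane) (hab : LinearIndependent ℝ ![a, b])
    (β : IFEM.Side → IFEM.Plane → ℝ) (β₀ β₁ : ℝ) (hβ₀ : 0 < β₀)
    (hβ : ∀ σ, ∀ x ∈ closure (G.sub σ), β₀ ≤ β σ x ∧ β σ x ≤ β₁) :
    (∃ κ : ℝ, 0 < κ ∧ ∃ N : ℕ, ∃ h₀ : ℝ, 0 < h₀ ∧
      ∀ h : ℝ, 0 < h → h < h₀ → ∀ M : IFEM.CutMesh G a b h,
        ∃ n : IFEM.Side → IFEM.Plane → ℕ, M.IsPatchChoice κ N n) ∧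
    (∀ κ : ℝ, 0 < κ → ∀ N : ℕ, ∃ C : ℝ≥0,
      ∀ h : ℝ, 0 < h → ∀ M : IFEM.CutMesh G a b h,
      ∀ n : IFEM.Side → IFEM.Plane → ℕ, M.IsPatchChoice κ N n →
      ∀ ξ : IFEM.Cell → IFEM.Side → IFEM.Plane, M.IsSampling ξ →
      ∀ v : IFEM.Cell → IFEM.Plane → ℝ, M.IFESpace β ξ v →
        eLpNorm (M.recover n v) 2 (volume.restrict (G.sub .minus ∪ G.sub .plus)) ≤
          C * M.brokenSeminorm v) := by
  have hc := IFEM.cross_ne_zero hab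
  refine ⟨?_, fun κ hκ N => IFEM.CutMesh.exists_stability hc hβ₀ hβ hκ N⟩
  obtain ⟨κm, hκm, Nm, hm, hm0, Hm⟩ := IFEM.CutMesh.exists_wellConditioned hc (hcone .minus)
  obtain ⟨κp, hκp, Np, hp, hp0, Hp⟩ := IFEM.CutMesh.exists_wellConditioned hc (hcone .plus)
  have mono : ∀ {κ κ' h : ℝ} {z : IFEM.Plane} {K : Finset IFEM.Plane}, κ' ≤ κ →
      IFEM.WellConditioned κ h z K → IFEM.WellConditioned κ' h z K := fun hκ H c =>
    (mul_le_mul_of_nonneg_right hκ (Finset.sum_nonneg fun _ _ => sq_nonneg _)).trans (H c)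
  refine ⟨min κm κp, lt_min hκm hκp, max Nm Np, min hm hp, lt_min hm0 hp0,
    fun h hh hlt M => ⟨fun σ _ => if σ = .minus then Nm else Np, fun σ z hz => ?_⟩⟩
  cases σ
  · exact ⟨le_max_left _ _,
      mono (min_le_left _ _) (Hm h hh (hlt.trans_le (min_le_left _ _)) M z hz)⟩
  · exact ⟨le_max_right _ _,
      mono (min_le_right _ _) (Hp h hh (hlt.trans_le (min_le_right _ _)) M z hz)⟩
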